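/- Let $N\ge 1$, $\varepsilon=1/N$, $\Lambda_N=\{1,\dots,N\}$, and let $\mathcal S_-$, $\mathcal S_+$ be two reservoirs with $N$ sites each. Put $\Sigma_N=\mathcal S_-\cup\Lambda_N\cup\mathcal S_+$. Consider the jump Markov process $(\eta(\cdot,s))_{s\ge0}$ on $\{0,1\}^{\Sigma_N}$ with generator $$\mathbf L^*f(\eta)=\frac12\sum_{x=1}^{N-1}\big[f(\eta^{x,x+1})-f(\eta)\big]+\frac1{2N}\sum_{z\in\mathcal S_-}\big[f(\eta^{1,z})-f(\eta)\big]+\frac1{2N}\sum_{z\in\mathcal S_+}\big[f(\eta^{N,z})-f(\eta)\big],$$ where $\eta^{x,y}$ is obtained from $\eta$ by exchanging $\eta(x)$ and $\eta(y)$; write $\mathbf E^{*,\varepsilon}$ for its expectation. Let $u_0:[0,1]\to[0,1]$ be continuously differentiable on $(0,1)$, and let integers $n_{0,\pm}$ (possibly depending on $N$) be given. Suppose that, for all large $N$, the initial law is such that: $\mathcal S_-$ and $\mathcal S_+$ contain $n_{0,-}$ and $n_{0,+}$ particles respectively, and in each reservoir these are uniformly distributed (all configurations with the given number of particles are equally likely);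 $\mathbf E^{*,\varepsilon}[\eta(x,0)]=u_0(\varepsilon x)$ for all $x\in\Lambda_N$; and $\eta(x,0)$, $\eta(y,0)$ are uncorrelated for any two distinct sites $x,y\in\Sigma_N$ which do not lie in the same reservoir (for instance, the occupation numbers in $\Lambda_N$ and the two reservoir configurations are all independent). Then for every $t>0$ and any distinct sites $x_1,x_2\in\Lambda_N$ (which may depend on $N$), $$\lim_{\varepsilon\to0}\Big|\mathbf E^{*,\varepsilon}\big[\eta(x_1,\varepsilon^{-2}t)\,\eta(x_2,\varepsilon^{-2}t)\big]-\mathbf E^{*,\varepsilon}[\eta(x_1,\varepsilon^{-2}t)]\,\mathbf E^{*,\varepsilon}[\eta(x_2,\varepsilon^{-2}t)]\Big|=0,$$ uniformly in the choice of $x_1\ne x_2$ in $\Lambda_N$. -/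

import Mathlib

open Filter Topology

namespace Stirring

/-- The channel `Λ_N = {1, …, N}`; an element is a natural number between `1` and `N`. -/
abbrev Channel (N : ℕ) : Type := {x : ℕ // x ∈ Finset.Icc 1 N}

/-- All sites: the channel `Λ_N`, the left reservoir `𝒮₋` and the right reservoir `𝒮₊`,
each reservoir having `M` sites. -/
abbrev Site (N M : ℕ) : Type := Channel N ⊕ (Fin M ⊕ Fin M)

/-- A channel site. -/
def chan {N M : ℕ} (x : Channel N) : Site N M := Sum.inl x

/-- A site of the left reservoir. -/
def left {N M : ℕ} (z : Fin M) : Site N M := Sum.inr (Sum.inl z)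

/-- A site of the right reservoir. -/
def right {N M : ℕ} (z : Fin M) : Site N M := Sum.inr (Sum.inr z)

/-- The state space `Ω* = {0,1}^{Λ_N ∪ 𝒮₋ ∪ 𝒮₊}`; `true` means that the site is occupied. -/
abbrev Config (N M : ℕ) : Type := Site N M → Bool

/-- The occupation number `η(x) ∈ {0,1}` as a real number. -/
def occ {N M : ℕ} (x : Site N M) (η : Config N M) : ℝ := if η x = true then 1 else 0

/-- The configuration `η^{x,y}`, obtained from `η` by exchanging the contents of `x` and `y`. -/
def exch {N M : ℕ} (x y : Site N M) (η : Config N M) : Config N M :=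
  fun w => η (Equiv.swap x y w)

/-- The change of `f` when the contents of `x` and `y` are exchanged. -/
def exchDiff {N M : ℕ} (x y : Site N M) : (Config N M → ℝ) →ₗ[ℝ] (Config N M → ℝ) where
  toFun f := fun η => f (exch x y η) - f η
  map_add' f g := by
    funext η
    simp only [Pi.add_apply]
    ring
  map_smul' c f := by
    funext η
    simp only [Pi.smul_apply, smul_eq_mul, RingHom.id_apply]
    ring

/-- The generator `L*` of the stirring process with reservoirs: neighbouring channel sites
exchange their contents at rate `1/2`, site `1` and each site of `𝒮₋` at rate `1/(2M)`, and
site `N` and each site of `𝒮₊` at rate `1/(2M)`. -/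
noncomputable def generator (N M : ℕ) : (Config N M → ℝ) →ₗ[ℝ] (Config N M → ℝ) :=
  (1 / 2 : ℝ) • (∑ x : Channel N, ∑ y : Channel N,
      if (x : ℕ) + 1 = (y : ℕ) then exchDiff (chan x) (chan y) else 0)
    + (1 / (2 * (M : ℝ))) • (∑ x : Channel N, ∑ z : Fin M,
      if (x : ℕ) = 1 then exchDiff (chan x) (left z) else 0)
    + (1 / (2 * (M : ℝ))) • (∑ x : Channel N, ∑ z : Fin M,
      if (x : ℕ) = N then exchDiff (chan x) (right z) else 0)

/-- The Markov semigroup `e^{t L*}` on functions on the finite state space: `semigroup N M t f η`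
is the expectation of `f` at time `t` for the jump process with generator `L*` started at `η`. -/
noncomputable def semigroup (N M : ℕ) (t : ℝ) : (Config N M → ℝ) →L[ℝ] (Config N M → ℝ) :=
  NormedSpace.exp (t • LinearMap.toContinuousLinearMap (generator N M))

/-- The expectation of `f` under a law `μ` on configurations. -/
noncomputable def mean {N M : ℕ} (μ : PMF (Config N M)) (f : Config N M → ℝ) : ℝ :=
  ∑ η : Config N M, (μ η).toReal * f η

/-- The expectation `𝐄*[f(η_t)]` for the jump Markov process with generator `L*` and initial
law `μ`. -/
noncomputable def expect {N M : ℕ} (μ : PMF (Config N M)) (t : ℝ) (f : Config N M → ℝ) : ℝ :=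
  mean μ (semigroup N M t f)

/-- The restriction of a configuration to the left reservoir. -/
def leftPart {N M : ℕ} (η : Config N M) : Fin M → Bool := fun z => η (left z)

/-- The restriction of a configuration to the right reservoir. -/
def rightPart {N M : ℕ} (η : Config N M) : Fin M → Bool := fun z => η (right z)

/-- The number of particles of a reservoir configuration. -/
def count {M : ℕ} (ζ : Fin M → Bool) : ℕ := (Finset.univ.filter fun z => ζ z = true).card

/-- A law of a reservoir configuration is uniform with `n` particles: there are almost surely `n`
particles, and all configurations with `n` particles have the same probability. -/
structure IsUniform {M : ℕ} (n : ℕ) (ν : PMF (Fin M → Bool)) : Prop where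
  count_eq : ∀ ζ, ν ζ ≠ 0 → count ζ = n
  uniform : ∀ ζ ζ', count ζ = n → count ζ' = n → ν ζ = ν ζ'

/-- Both sites belong to the same reservoir. -/
def SameReservoir {N M : ℕ} (x y : Site N M) : Prop :=
  (∃ z z' : Fin M, x = left z ∧ y = left z') ∨ (∃ z z' : Fin M, x = right z ∧ y = right z')

/-- Admissible initial laws for the system with `M = N`. The reservoirs hold `nL` and `nR`
uniformly distributed particles, the mean occupation of `x ∈ Λ_N` is `u₀ (x / N)`, and the initial
occupation numbers of distinct sites that are not in the same reservoir are uncorrelated (which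
holds in particular if the occupation numbers in the channel and the two reservoir configurations
are all independent). -/
structure IsInitialLaw (N : ℕ) (u₀ : ℝ → ℝ) (nL nR : ℕ) (μ : PMF (Config N N)) : Prop where
  left_uniform : IsUniform nL (μ.map leftPart)
  right_uniform : IsUniform nR (μ.map rightPart)
  profile : ∀ x : Channel N, mean μ (occ (chan x)) = u₀ ((x : ℕ) / (N : ℝ))
  uncorrelated : ∀ x y : Site N N, x ≠ y → ¬ SameReservoir x y →
    mean μ (fun η => occ x η * occ y η) = mean μ (occ x) * mean μ (occ y)

end Stirring

/-!
The occupation numbers of the stirring process are self-dual. Hence `u_s x`, the mean of the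
occupation number of `x`, solves the heat equation of one stirred particle, and the truncated
correlation `v_s (x, y)` solves, for `x ≠ y`, the heat equation of two particles that exclude each
other, with a source `-r_{xy} (u_s x - u_s y)²` on the bonds. Initially `v` is `O(1 / N)`: only
sites of the same reservoir are correlated, as in a hypergeometric law. All comparisons rest on one
maximum principle (`maximum_principle`), proved with the energy of the positive part.

Since the source is nonpositive, upper bounds on `v` persist (`IsCorrelationFlow.le`). For the lower
bound the time interval `[0, N² t]` is split at `S = σ N²`.

* Until `S` the correlations are dominated by the variance of `u_0` under the one-particle walk
  (`IsCorrelationFlow.neg_le_variance`). The sum of these variances over the sites is the `ℓ²`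
  energy dissipated until `S`, which is at most a small multiple of `N` because `u_0` is `ℓ²`-close
  to a Lipschitz profile (`IsHeatFlow.sum_sq_sub_le`, `IsInitialLaw.exists_approximation`). The
  remaining time is of order `N²` and spreads this mass, so that its contribution is small at every
  channel site (`IsHeatFlow.energy_le`, `sq_chan_le`).
* After `S` the increments of `u` across bonds are `O(1 / N)` (`IsHeatFlow.energy_le`,
  `sq_sub_le_of_rate_ne_zero`), so the source is `O(1 / N²)` times the rate of the bond between the
  particles. The distance of the two particles grows at the rate at which they use that bond, up to
  a drift of order `1 / N` from the reservoirs. As the distance is at most `N + 1`, the time the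
  particles spend at a common bond is `O(N)`, and the source contributes `O(1 / N)`
  (`IsCorrelationFlow.neg_le_of_gradient_le`).
-/

namespace Stirring

/-! ### Heat flows of interchange dynamics on a finite set -/

section Interchange

variable {ι : Type*} [Fintype ι]

/-- The Dirichlet form of the walk, `-⟨g, walkGen r f⟩` for the counting measure; see
`sum_mul_walkGen`. -/
def dirichlet (r : ι → ι → ℝ) (g f : ι → ℝ) : ℝ :=
  ∑ i, ∑ j, r i j * ((g i - g j) * (f i - f j))

theorem dirichlet_comm (r : ι → ι → ℝ) (g f : ι → ℝ) : dirichlet r g f = dirichlet r f g := by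
  simp only [dirichlet, mul_comm]

theorem dirichlet_self_nonneg {r : ι → ι → ℝ} (hr : ∀ i j, 0 ≤ r i j) (f : ι → ℝ) :
    0 ≤ dirichlet r f f :=
  Finset.sum_nonneg fun i _ => Finset.sum_nonneg fun j _ =>
    mul_nonneg (hr i j) (mul_self_nonneg _)

theorem two_mul_dirichlet_le {r : ι → ι → ℝ} (hr : ∀ i j, 0 ≤ r i j) (g f : ι → ℝ) :
    2 * dirichlet r g f ≤ dirichlet r g g + dirichlet r f f := by
  simp only [dirichlet, Finset.mul_sum, ← Finset.sum_add_distrib]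
  refine Finset.sum_le_sum fun i _ => Finset.sum_le_sum fun j _ => ?_
  nlinarith [mul_nonneg (hr i j) (sq_nonneg ((g i - g j) - (f i - f j)))]

variable [DecidableEq ι]

/-- The generator of one particle under interchange dynamics: for each ordered pair `(i, j)`, at
rate `r i j`, the contents of `i` and `j` are exchanged, and a particle at `x` moves to
`Equiv.swap i j x`. The rates need not be symmetric: the bond `{i, j}` has the total rate
`r i j + r j i`. -/
noncomputable def walkGen (r : ι → ι → ℝ) : (ι → ℝ) →L[ℝ] (ι → ℝ) :=
  LinearMap.toContinuousLinearMap
    { toFun := fun f x => ∑ i, ∑ j, r i j * (f (Equiv.swap i j x) - f x)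
      map_add' := fun f g => by
        funext x
        simp only [Pi.add_apply, ← Finset.sum_add_distrib]
        exact Finset.sum_congr rfl fun i _ => Finset.sum_congr rfl fun j _ => by ring
      map_smul' := fun c f => by
        funext x
        simp only [Pi.smul_apply, smul_eq_mul, RingHom.id_apply, Finset.mul_sum]
        exact Finset.sum_congr rfl fun i _ => Finset.sum_congr rfl fun j _ => by ring }

theorem walkGen_apply (r : ι → ι → ℝ) (f : ι → ℝ) (x : ι) :
    walkGen r f x = ∑ i, ∑ j, r i j * (f (Equiv.swap i j x) - f x) := rfl

/-- Only the sites `i` and `j` contribute, and the two contributions combine into a product of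
increments. -/
theorem sum_mul_swap_sub (g f : ι → ℝ) (i j : ι) :
    ∑ x, g x * (f (Equiv.swap i j x) - f x) = -((g i - g j) * (f i - f j)) := by
  by_cases hij : i = j
  · subst hij; simp
  rw [Fintype.sum_eq_add i j hij]
  · simp only [Equiv.swap_apply_left, Equiv.swap_apply_right]; ring
  · rintro x ⟨h1, h2⟩
    rw [Equiv.swap_apply_of_ne_of_ne h1 h2]; simp

theorem sum_mul_walkGen (r : ι → ι → ℝ) (g f : ι → ℝ) :
    ∑ x, g x * walkGen r f x = -dirichlet r g f := by
  simp only [walkGen_apply, dirichlet, Finset.mul_sum]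
  rw [Finset.sum_comm, ← Finset.sum_neg_distrib]
  refine Finset.sum_congr rfl fun i _ => ?_
  rw [Finset.sum_comm, ← Finset.sum_neg_distrib]
  refine Finset.sum_congr rfl fun j _ => ?_
  rw [← mul_neg, ← sum_mul_swap_sub, Finset.mul_sum]
  exact Finset.sum_congr rfl fun x _ => by ring

theorem sum_mul_walkGen_comm (r : ι → ι → ℝ) (g f : ι → ℝ) :
    ∑ x, g x * walkGen r f x = ∑ x, f x * walkGen r g x := by
  rw [sum_mul_walkGen, sum_mul_walkGen, dirichlet_comm]

theorem sum_walkGen (r : ι → ι → ℝ) (f : ι → ℝ) : ∑ x, walkGen r f x = 0 := by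
  have := sum_mul_walkGen r (fun _ => 1) f
  simpa [dirichlet] using this

/-- A curve of functions that solves the heat equation `u' = walkGen r u`. -/
def IsHeatFlow (r : ι → ι → ℝ) (u : ℝ → ι → ℝ) : Prop :=
  ∀ s, HasDerivAt u (walkGen r (u s)) s

/-- Both forms of the derivative of a semigroup: the generator acts after it or before it. -/
theorem hasDerivAt_exp_smul_apply {E : Type*} [NormedAddCommGroup E] [NormedSpace ℝ E]
    [CompleteSpace E] (A : E →L[ℝ] E) (f : E) (s : ℝ) :
    HasDerivAt (fun s : ℝ => NormedSpace.exp (s • A) f) (A (NormedSpace.exp (s • A) f)) s ∧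
    HasDerivAt (fun s : ℝ => NormedSpace.exp (s • A) f) (NormedSpace.exp (s • A) (A f)) s := by
  constructor
  · simpa using (hasDerivAt_exp_smul_const' (𝕂 := ℝ) A s).clm_apply (hasDerivAt_const s f)
  · simpa using (hasDerivAt_exp_smul_const (𝕂 := ℝ) A s).clm_apply (hasDerivAt_const s f)

theorem exists_isHeatFlow (r : ι → ι → ℝ) (a : ℝ) (f : ι → ℝ) :
    ∃ u, IsHeatFlow r u ∧ u a = f := by
  refine ⟨fun s => NormedSpace.exp ((s - a) • walkGen r) f, fun s => ?_, by simp⟩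
  have h := (hasDerivAt_exp_smul_apply (walkGen r) f (s - a)).1
  exact h.comp_sub_const s a

theorem IsHeatFlow.hasDerivAt_apply {r : ι → ι → ℝ} {u : ℝ → ι → ℝ} (hu : IsHeatFlow r u)
    (s : ℝ) (x : ι) : HasDerivAt (fun s => u s x) (walkGen r (u s) x) s :=
  hasDerivAt_pi.1 (hu s) x

theorem IsHeatFlow.map_walkGen {r : ι → ι → ℝ} {u : ℝ → ι → ℝ} (hu : IsHeatFlow r u) :
    IsHeatFlow r fun s => walkGen r (u s) := fun s =>
  ((walkGen r).hasFDerivAt.comp_hasDerivAt s (hu s))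

theorem le_of_hasDerivAt_nonpos {f f' : ℝ → ℝ} {a b : ℝ} (hab : a ≤ b)
    (hf : ∀ s, HasDerivAt f (f' s) s) (hf' : ∀ s, a ≤ s → f' s ≤ 0) : f b ≤ f a := by
  refine antitoneOn_of_deriv_nonpos (convex_Ici a)
    (fun s _ => (hf s).continuousAt.continuousWithinAt)
    (fun s _ => (hf s).differentiableAt.differentiableWithinAt) ?_ Set.self_mem_Ici hab hab
  intro s hs
  rw [(hf s).deriv]
  exact hf' s (interior_subset hs)

theorem IsHeatFlow.sum_eq {r : ι → ι → ℝ} {u : ℝ → ι → ℝ} (hu : IsHeatFlow r u) (s a : ℝ) :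
    ∑ x, u s x = ∑ x, u a x := by
  refine is_const_of_deriv_eq_zero (f := fun s => ∑ x, u s x) ?_ ?_ s a
  · exact fun s => (HasDerivAt.fun_sum fun x _ => hu.hasDerivAt_apply s x).differentiableAt
  · intro s
    rw [(HasDerivAt.fun_sum fun x _ => hu.hasDerivAt_apply s x).deriv, sum_walkGen]

theorem IsHeatFlow.hasDerivAt_sum_sq {r : ι → ι → ℝ} {u : ℝ → ι → ℝ} (hu : IsHeatFlow r u)
    (s : ℝ) : HasDerivAt (fun s => ∑ x, u s x ^ 2) (-(2 * dirichlet r (u s) (u s))) s := by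
  have h := HasDerivAt.fun_sum (u := Finset.univ) fun x _ => (hu.hasDerivAt_apply s x).fun_pow 2
  refine h.congr_deriv ?_
  rw [← mul_neg, ← sum_mul_walkGen, Finset.mul_sum]
  exact Finset.sum_congr rfl fun x _ => by push_cast; ring

theorem IsHeatFlow.hasDerivAt_dirichlet {r : ι → ι → ℝ} {u : ℝ → ι → ℝ} (hu : IsHeatFlow r u)
    (s : ℝ) : HasDerivAt (fun s => dirichlet r (u s) (u s))
      (-(2 * ∑ x, walkGen r (u s) x ^ 2)) s := by
  have h := (HasDerivAt.fun_sum (u := Finset.univ) fun x _ =>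
    (hu.hasDerivAt_apply s x).mul (hu.map_walkGen.hasDerivAt_apply s x)).neg
  have e : (fun s => dirichlet r (u s) (u s))
      = -fun s => ∑ x, u s x * walkGen r (u s) x := by
    funext s; simp [sum_mul_walkGen]
  rw [e]
  refine h.congr_deriv ?_
  rw [Finset.sum_add_distrib, sum_mul_walkGen_comm r (u s), ← two_mul]
  simp only [pow_two]

/-- One Lyapunov function contains all the smoothing that is needed: with `D` the Dirichlet form and
`Z = ∑ (walkGen r u)²`, one has `(∑ u²)' = -2 D`, `D' = -2 Z` and `Z' ≤ 0`, so that the weights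
`1`, `2 τ`, `2 τ²` make the derivatives telescope. -/
theorem IsHeatFlow.energy_le {r : ι → ι → ℝ} (hr : ∀ i j, 0 ≤ r i j) {u : ℝ → ι → ℝ}
    (hu : IsHeatFlow r u) {a s : ℝ} (has : a ≤ s) :
    ∑ x, u s x ^ 2 + 2 * (s - a) * dirichlet r (u s) (u s)
      + 2 * (s - a) ^ 2 * ∑ x, walkGen r (u s) x ^ 2 ≤ ∑ x, u a x ^ 2 := by
  have hid (s : ℝ) : HasDerivAt (fun s => s - a) 1 s := (hasDerivAt_id s).sub_const a
  have key := le_of_hasDerivAt_nonpos (f := fun s => ∑ x, u s x ^ 2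
      + 2 * (s - a) * dirichlet r (u s) (u s)
      + 2 * (s - a) ^ 2 * ∑ x, walkGen r (u s) x ^ 2) has
    (fun s => ((hu.hasDerivAt_sum_sq s).add
      (((hid s).const_mul 2).mul (hu.hasDerivAt_dirichlet s))).add
      ((((hid s).pow 2).const_mul 2).mul (hu.map_walkGen.hasDerivAt_sum_sq s))) ?_
  · simpa using key
  · intro s hs
    have h := mul_nonneg (sq_nonneg (s - a))
      (dirichlet_self_nonneg hr (walkGen r (u s)))
    simp only [Pi.pow_apply]
    push_cast
    nlinarith

/-- The `ℓ²` norm dissipates little over a short time when the initial value is `ℓ²`-close to a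
function `f` of small Dirichlet energy. -/
theorem IsHeatFlow.sum_sq_sub_le {r : ι → ι → ℝ} (hr : ∀ i j, 0 ≤ r i j) {u : ℝ → ι → ℝ}
    (hu : IsHeatFlow r u) {a s : ℝ} (has : a ≤ s) (f : ι → ℝ) :
    ∑ x, u a x ^ 2 - ∑ x, u s x ^ 2
      ≤ 2 * (s - a) * dirichlet r f f + 2 * ∑ x, (u a x - f x) ^ 2 := by
  -- `2 ⟨u_a - u_s, f⟩` grows at rate `2 𝓓(u_s, f) ≤ 𝓓(u_s, u_s) + 𝓓(f, f)`, and the first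
  -- summand is half the rate at which `|u_s|²` decreases
  have hlin : 2 * ∑ x, f x * (u a x - u s x)
      ≤ (∑ x, u a x ^ 2 - ∑ x, u s x ^ 2) / 2 + (s - a) * dirichlet r f f := by
    have hd (s : ℝ) := ((HasDerivAt.fun_sum (u := Finset.univ) fun x _ =>
      ((hu.hasDerivAt_apply s x).const_sub (u a x)).const_mul (f x)).const_mul 2)
    have key := le_of_hasDerivAt_nonpos (f := fun s => 2 * ∑ x, f x * (u a x - u s x)
        + (∑ x, u s x ^ 2) / 2 - (s - a) * dirichlet r f f) has
      (fun s => ((hd s).add ((hu.hasDerivAt_sum_sq s).div_const 2)).sub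
        (((hasDerivAt_id s).sub_const a).mul_const _)) ?_
    · simp only [sub_self, mul_zero, Finset.sum_const_zero, zero_mul] at key
      linarith
    · intro s _
      have e : ∑ x, f x * -walkGen r (u s) x = dirichlet r (u s) f := by
        simp only [mul_neg, Finset.sum_neg_distrib, sum_mul_walkGen, neg_neg, dirichlet_comm r f]
      rw [e]
      linarith [two_mul_dirichlet_le hr (u s) f]
  have hpt : ∑ x, u a x ^ 2 - ∑ x, u s x ^ 2
      ≤ 2 * ∑ x, f x * (u a x - u s x) + ∑ x, (u a x - f x) ^ 2 := by
    rw [Finset.mul_sum, ← Finset.sum_sub_distrib, ← Finset.sum_add_distrib]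
    refine Finset.sum_le_sum fun x _ => ?_
    nlinarith [sq_nonneg (u s x - f x)]
  linarith

/-- The maximum principle for a generator `∑ b, w b * (F ∘ σ b - F)` with permutations `σ b`: since
the counting measure is invariant, `∑ p, (max (F p) 0)²` is nonincreasing along a subsolution. -/
theorem maximum_principle {κ β : Type*} [Fintype κ] [Fintype β] {w : β → ℝ} (hw : ∀ b, 0 ≤ w b)
    (σ : β → Equiv.Perm κ) {F F' : ℝ → κ → ℝ} {a : ℝ}
    (hF : ∀ s p, HasDerivAt (fun s => F s p) (F' s p) s)
    (hF' : ∀ s, a ≤ s → ∀ p, F' s p ≤ ∑ b, w b * (F s (σ b p) - F s p))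
    (h0 : ∀ p, F a p ≤ 0) {s : ℝ} (hs : a ≤ s) (p : κ) : F s p ≤ 0 := by
  -- the square of the positive part is differentiable, also at `0`
  have hsq (y : ℝ) : HasDerivAt (fun y : ℝ => max y 0 ^ 2) (2 * max y 0) y := by
    rcases lt_trichotomy y 0 with h | h | h
    · refine ((hasDerivAt_const y (0 : ℝ)).congr_of_eventuallyEq ?_).congr_deriv
        (by rw [max_eq_right h.le, mul_zero])
      filter_upwards [Iio_mem_nhds h] with z hz
      rw [max_eq_right (le_of_lt hz)]; norm_num
    · subst h
      rw [max_self, mul_zero, hasDerivAt_iff_isLittleO]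
      simp only [max_self, sub_zero, smul_zero]
      have : (fun y : ℝ => max y 0 ^ 2) =O[𝓝 0] fun y => y ^ 2 := by
        refine Asymptotics.isBigO_of_le _ fun y => ?_
        simp only [norm_pow, Real.norm_eq_abs]
        refine pow_le_pow_left₀ (abs_nonneg _) ?_ 2
        rw [abs_of_nonneg (le_max_right y 0)]
        exact max_le (le_abs_self y) (abs_nonneg y)
      refine (by simpa using this.trans_isLittleO (Asymptotics.isLittleO_pow_id one_lt_two))
    · refine ((hasDerivAt_pow 2 y).congr_of_eventuallyEq ?_).congr_deriv
        (by rw [max_eq_left h.le]; norm_num)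
      filter_upwards [Ioi_mem_nhds h] with z hz
      rw [max_eq_left (le_of_lt hz)]
  have key := le_of_hasDerivAt_nonpos (f := fun s => ∑ p, max (F s p) 0 ^ 2) hs
    (fun s => HasDerivAt.fun_sum fun p _ => (hsq (F s p)).comp s (hF s p)) ?_
  · have h1 : ∑ p, max (F a p) 0 ^ 2 = 0 :=
      Finset.sum_eq_zero fun p _ => by rw [max_eq_right (h0 p)]; norm_num
    have h2 := Finset.single_le_sum (f := fun p => max (F s p) 0 ^ 2)
      (fun p _ => sq_nonneg _) (Finset.mem_univ p)
    have h3 : max (F s p) 0 ^ 2 ≤ 0 := by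
      linarith
    have h4 : max (F s p) 0 = 0 := by simpa using le_antisymm h3 (sq_nonneg _)
    exact max_eq_right_iff.1 h4
  · intro s has
    have hp (p : κ) : 2 * max (F s p) 0 * F' s p
        ≤ ∑ b, w b * (max (F s (σ b p)) 0 ^ 2 - max (F s p) 0 ^ 2) := by
      have hm : 0 ≤ max (F s p) 0 := le_max_right _ _
      refine (mul_le_mul_of_nonneg_left (hF' s has p) (by positivity)).trans ?_
      rw [Finset.mul_sum]
      refine Finset.sum_le_sum fun b _ => ?_
      have h1 : max (F s p) 0 * F s p = max (F s p) 0 ^ 2 := by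
        rcases le_total (F s p) 0 with h | h
        · rw [max_eq_right h]; norm_num
        · rw [max_eq_left h]; ring
      have h2 : max (F s p) 0 * F s (σ b p) ≤ max (F s p) 0 * max (F s (σ b p)) 0 :=
        mul_le_mul_of_nonneg_left (le_max_left _ _) hm
      have h3 := sq_nonneg (max (F s p) 0 - max (F s (σ b p)) 0)
      have : 2 * max (F s p) 0 * (F s (σ b p) - F s p)
          ≤ max (F s (σ b p)) 0 ^ 2 - max (F s p) 0 ^ 2 := by nlinarith
      calc _ = w b * (2 * max (F s p) 0 * (F s (σ b p) - F s p)) := by ring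
        _ ≤ _ := mul_le_mul_of_nonneg_left this (hw b)
    refine (Finset.sum_le_sum fun p _ => hp p).trans ?_
    rw [Finset.sum_comm]
    refine le_of_eq (Finset.sum_eq_zero fun b _ => ?_)
    rw [← Finset.mul_sum, Finset.sum_sub_distrib,
      Equiv.sum_comp (σ b) fun p => max (F s p) 0 ^ 2, sub_self, mul_zero]

/-! ### Two exclusion particles and the truncated correlations -/

/-- The generator of two labelled particles that see the same exchanges. -/
def pairGen (r : ι → ι → ℝ) (F : ι → ι → ℝ) (x y : ι) : ℝ :=
  ∑ i, ∑ j, r i j * (F (Equiv.swap i j x) (Equiv.swap i j y) - F x y)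

/-- The sum over the bonds of the products of the increments of `f` at `x` and at `y` that the
exchange causes. On the diagonal this is the carré du champ of `f`, in the normalization without the
factor `1 / 2`; for `x ≠ y` only the bond `{x, y}` contributes, with `-(f x - f y)²`. -/
def gradProd (r : ι → ι → ℝ) (f : ι → ℝ) (x y : ι) : ℝ :=
  ∑ i, ∑ j, r i j * ((f (Equiv.swap i j x) - f x) * (f (Equiv.swap i j y) - f y))

/-- An exchange fixes one of two distinct sites or exchanges them with each other. -/
theorem swap_trichotomy {α : Type*} [DecidableEq α] (i j : α) {x y : α} (hxy : x ≠ y) :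
    Equiv.swap i j x = x ∨ Equiv.swap i j y = y ∨
      (Equiv.swap i j x = y ∧ Equiv.swap i j y = x ∧ (x = i ∧ y = j ∨ x = j ∧ y = i)) := by
  by_cases h1 : x = i
  · subst h1
    by_cases h2 : y = j
    · subst h2; simp
    · exact Or.inr (Or.inl (Equiv.swap_apply_of_ne_of_ne hxy.symm h2))
  · by_cases h2 : x = j
    · subst h2
      by_cases h3 : y = i
      · subst h3; simp
      · exact Or.inr (Or.inl (Equiv.swap_apply_of_ne_of_ne h3 hxy.symm))
    · exact Or.inl (Equiv.swap_apply_of_ne_of_ne h1 h2)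

/-- The maximum principle for two particles. Exchanges are injective, so off-diagonal pairs stay
off-diagonal and nothing is needed on the diagonal. -/
theorem pair_maximum_principle {r : ι → ι → ℝ} (hr : ∀ i j, 0 ≤ r i j) {F F' : ℝ → ι → ι → ℝ}
    {a : ℝ} (hF : ∀ s x y, x ≠ y → HasDerivAt (fun s => F s x y) (F' s x y) s)
    (hF' : ∀ s, a ≤ s → ∀ x y, x ≠ y → F' s x y ≤ pairGen r (F s) x y)
    (h0 : ∀ x y, x ≠ y → F a x y ≤ 0) {s : ℝ} (hs : a ≤ s) {x y : ι} (hxy : x ≠ y) :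
    F s x y ≤ 0 := by
  let σ : ι × ι → Equiv.Perm {p : ι × ι // p.1 ≠ p.2} := fun b =>
    (Equiv.prodCongr (Equiv.swap b.1 b.2) (Equiv.swap b.1 b.2)).subtypeEquiv fun p => by simp
  refine maximum_principle (κ := {p : ι × ι // p.1 ≠ p.2}) (β := ι × ι)
    (w := fun b => r b.1 b.2) (fun b => hr _ _) σ (F := fun s p => F s p.1.1 p.1.2)
    (F' := fun s p => F' s p.1.1 p.1.2) (fun s p => hF s _ _ p.2)
    (fun s has p => (hF' s has _ _ p.2).trans_eq ?_) (fun p => h0 _ _ p.2) hs ⟨(x, y), hxy⟩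
  rw [Fintype.sum_prod_type]
  rfl

theorem IsHeatFlow.le_of_le {r : ι → ι → ℝ} (hr : ∀ i j, 0 ≤ r i j) {u : ℝ → ι → ℝ}
    (hu : IsHeatFlow r u) {a s c : ℝ} (h0 : ∀ x, u a x ≤ c) (hs : a ≤ s) (x : ι) :
    u s x ≤ c := by
  refine sub_nonpos.1 (maximum_principle (κ := ι) (β := ι × ι) (w := fun b => r b.1 b.2)
    (fun b => hr _ _) (fun b => Equiv.swap b.1 b.2) (F := fun s x => u s x - c)
    (F' := fun s x => walkGen r (u s) x) (fun s x => (hu.hasDerivAt_apply s x).sub_const c)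
    (fun s _ x => le_of_eq ?_) (fun x => sub_nonpos.2 (h0 x)) hs x)
  rw [walkGen_apply, Fintype.sum_prod_type]
  simp

theorem walkGen_sq (r : ι → ι → ℝ) (f : ι → ℝ) (x : ι) :
    walkGen r (fun x => f x ^ 2) x = 2 * f x * walkGen r f x + gradProd r f x x := by
  simp only [walkGen_apply, gradProd, Finset.mul_sum, ← Finset.sum_add_distrib]
  exact Finset.sum_congr rfl fun i _ => Finset.sum_congr rfl fun j _ => by ring

/-- The square of a heat flow is a subsolution of the heat equation; the difference `p - u ^ 2` is
the variance of `u a` under the walk when `p a = u a ^ 2`. -/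
theorem IsHeatFlow.sq_le {r : ι → ι → ℝ} (hr : ∀ i j, 0 ≤ r i j) {u p : ℝ → ι → ℝ}
    (hu : IsHeatFlow r u) (hp : IsHeatFlow r p) {a s : ℝ} (h0 : ∀ x, u a x ^ 2 ≤ p a x)
    (hs : a ≤ s) (x : ι) : u s x ^ 2 ≤ p s x := by
  refine sub_nonpos.1 (maximum_principle (κ := ι) (β := ι × ι) (w := fun b => r b.1 b.2)
    (fun b => hr _ _) (fun b => Equiv.swap b.1 b.2) (F := fun s x => u s x ^ 2 - p s x)
    (fun s x => ((hu.hasDerivAt_apply s x).fun_pow 2).sub (hp.hasDerivAt_apply s x))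
    (fun s _ x => ?_) (fun x => sub_nonpos.2 (h0 x)) hs x)
  have e : ∑ b : ι × ι, r b.1 b.2 * (u s (Equiv.swap b.1 b.2 x) ^ 2
      - p s (Equiv.swap b.1 b.2 x) - (u s x ^ 2 - p s x))
      = walkGen r (fun x => u s x ^ 2) x - walkGen r (p s) x := by
    rw [walkGen_apply, walkGen_apply, Fintype.sum_prod_type]
    simp only [← Finset.sum_sub_distrib]
    exact Finset.sum_congr rfl fun i _ => Finset.sum_congr rfl fun j _ => by ring
  have h : 0 ≤ gradProd r (u s) x x := Finset.sum_nonneg fun i _ => Finset.sum_nonneg fun j _ =>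
    mul_nonneg (hr i j) (mul_self_nonneg _)
  rw [e, walkGen_sq]
  push_cast
  simp only [pow_one]
  linarith

/-- The equation of the truncated correlations `v` for the one-point function `u`: off the diagonal
`v` solves the two-particle heat equation with the source `gradProd r u`. The source arises because
the increment of `u x * u y` under an exchange is the sum of the two Leibniz terms and of the
product of the increments. -/
def IsCorrelationFlow (r : ι → ι → ℝ) (u : ℝ → ι → ℝ) (v : ℝ → ι → ι → ℝ) : Prop :=
  ∀ s x y, x ≠ y →
    HasDerivAt (fun s => v s x y) (pairGen r (v s) x y + gradProd r (u s) x y) s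

theorem gradProd_nonpos {r : ι → ι → ℝ} (hr : ∀ i j, 0 ≤ r i j) (f : ι → ℝ) {x y : ι}
    (hxy : x ≠ y) : gradProd r f x y ≤ 0 := by
  refine Finset.sum_nonpos fun i _ => Finset.sum_nonpos fun j _ =>
    mul_nonpos_of_nonneg_of_nonpos (hr i j) ?_
  rcases swap_trichotomy i j hxy with h | h | ⟨h1, h2, -⟩
  · rw [h]; simp
  · rw [h]; simp
  · rw [h1, h2]; nlinarith [sq_nonneg (f x - f y)]

theorem neg_gradProd_le {r : ι → ι → ℝ} (hr : ∀ i j, 0 ≤ r i j) (f : ι → ℝ) {x y : ι}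
    (hxy : x ≠ y) : -gradProd r f x y ≤ gradProd r f x x := by
  rw [← sub_nonneg, sub_neg_eq_add]
  simp only [gradProd, ← Finset.sum_add_distrib, ← mul_add]
  refine Finset.sum_nonneg fun i _ => Finset.sum_nonneg fun j _ => mul_nonneg (hr i j) ?_
  rcases swap_trichotomy i j hxy with h | h | ⟨h1, h2, -⟩
  · rw [h]; simp
  · rw [h]; simpa using mul_self_nonneg _
  · rw [h1, h2]; nlinarith

/-- The source is nonpositive off the diagonal, hence upper bounds on the correlations persist. -/
theorem IsCorrelationFlow.le {r : ι → ι → ℝ} (hr : ∀ i j, 0 ≤ r i j) {u : ℝ → ι → ℝ}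
    {v : ℝ → ι → ι → ℝ} (hv : IsCorrelationFlow r u v) {a s c : ℝ}
    (h0 : ∀ x y, x ≠ y → v a x y ≤ c) (hs : a ≤ s) {x y : ι} (hxy : x ≠ y) : v s x y ≤ c := by
  refine sub_nonpos.1 (pair_maximum_principle hr (F := fun s x y => v s x y - c)
    (fun s x y hxy => (hv s x y hxy).sub_const c) (fun s _ x y hxy => ?_)
    (fun x y hxy => sub_nonpos.2 (h0 x y hxy)) hs hxy)
  have e : pairGen r (fun x y => v s x y - c) x y = pairGen r (v s) x y := by
    simp [pairGen]
  rw [e]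
  linarith [gradProd_nonpos hr (u s) hxy]

/-- A lower bound without any smoothness: the source is in absolute value at most the carré du champ
of `u` at one of the two sites, which is exactly the source in the equation of the variance `p -
u²`. -/
theorem IsCorrelationFlow.neg_le_variance {r : ι → ι → ℝ} (hr : ∀ i j, 0 ≤ r i j)
    {u p : ℝ → ι → ℝ} {v : ℝ → ι → ι → ℝ} (hv : IsCorrelationFlow r u v) (hu : IsHeatFlow r u)
    (hp : IsHeatFlow r p) {a s c : ℝ} (hup : ∀ x, u a x ^ 2 ≤ p a x)
    (h0 : ∀ x y, x ≠ y → -v a x y ≤ c) (hs : a ≤ s) {x y : ι} (hxy : x ≠ y) :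
    -v s x y ≤ c + (p s x - u s x ^ 2) := by
  refine sub_nonpos.1 (pair_maximum_principle hr
    (F := fun s x y => -v s x y - (c + (p s x - u s x ^ 2)))
    (fun s x y hxy => (hv s x y hxy).neg.sub (((hp.hasDerivAt_apply s x).sub
      ((hu.hasDerivAt_apply s x).fun_pow 2)).const_add c)) (fun s _ x y hxy => ?_)
    (fun x y hxy => by linarith [hup x, h0 x y hxy]) hs hxy)
  have e : pairGen r (fun x y => -v s x y - (c + (p s x - u s x ^ 2))) x y
      = -pairGen r (v s) x y - walkGen r (p s) x + walkGen r (fun x => u s x ^ 2) x := by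
    simp only [pairGen, walkGen_apply, ← Finset.sum_neg_distrib, ← Finset.sum_sub_distrib,
      ← Finset.sum_add_distrib]
    exact Finset.sum_congr rfl fun i _ => Finset.sum_congr rfl fun j _ => by ring
  rw [e, walkGen_sq]
  push_cast
  simp only [pow_one]
  linarith [neg_gradProd_le hr (u s) hxy]

/-- A lower bound once the gradient of `u` on bonds is small. The supersolution contains
`R - |π x - π y|`: two particles that exclude each other gain distance at the rate at which they
use the bond between them, up to the drift of `π`, so the time at that bond is of the order of the
diameter `R`. -/
theorem IsCorrelationFlow.neg_le_of_gradient_le {r : ι → ι → ℝ} (hr : ∀ i j, 0 ≤ r i j)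
    {u Φ : ℝ → ι → ℝ} {v : ℝ → ι → ι → ℝ} (hv : IsCorrelationFlow r u v)
    (hΦ : IsHeatFlow r Φ) {a s c G R η : ℝ} {π : ι → ℝ}
    (hπ : ∀ i j, r i j ≠ 0 → 1 ≤ |π i - π j|) (hR : ∀ x y, |π x - π y| ≤ R)
    (hη : ∀ x, |walkGen r π x| ≤ η)
    (hG : ∀ s, a ≤ s → ∀ i j, r i j ≠ 0 → (u s i - u s j) ^ 2 ≤ G)
    (h0 : ∀ x y, x ≠ y → -v a x y ≤ c + Φ a x) (hs : a ≤ s) {x y : ι} (hxy : x ≠ y)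
    (hG0 : 0 ≤ G) :
    -v s x y ≤ c + Φ s x + G / 2 * (R + 2 * η * (s - a)) := by
  suffices h : -v s x y ≤ c + (Φ s x + G / 2 * (R - |π x - π y| + 2 * η * (s - a))) by
    have : G / 2 * (R - |π x - π y| + 2 * η * (s - a)) ≤ G / 2 * (R + 2 * η * (s - a)) :=
      mul_le_mul_of_nonneg_left (by linarith [abs_nonneg (π x - π y)]) (by linarith)
    linarith
  have hid (s : ℝ) : HasDerivAt (fun s => s - a) 1 s := (hasDerivAt_id s).sub_const a
  refine sub_nonpos.1 (pair_maximum_principle hr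
    (F := fun s x y =>
      -v s x y - (c + (Φ s x + G / 2 * (R - |π x - π y| + 2 * η * (s - a)))))
    (fun s x y hxy => (hv s x y hxy).neg.sub (((hΦ.hasDerivAt_apply s x).add
      ((((hid s).const_mul (2 * η)).const_add (R - |π x - π y|)).const_mul (G / 2))).const_add c))
    (fun s has x y hxy => ?_)
    (fun x y hxy => ?_) hs hxy)
  · have e : pairGen r (fun x y =>
        -v s x y - (c + (Φ s x + G / 2 * (R - |π x - π y| + 2 * η * (s - a))))) x y
        = -pairGen r (v s) x y - walkGen r (Φ s) x
          + G / 2 * pairGen r (fun x y => |π x - π y|) x y := by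
      simp only [pairGen, walkGen_apply, ← Finset.sum_neg_distrib, ← Finset.sum_sub_distrib,
        ← Finset.sum_add_distrib, Finset.mul_sum]
      exact Finset.sum_congr rfl fun i _ => Finset.sum_congr rfl fun j _ => by ring
    have hsign : ∃ ε : ℝ, |ε| = 1 ∧ |π x - π y| = ε * (π y - π x) := by
      rcases le_total (π x) (π y) with h | h
      · exact ⟨1, by simp, by rw [abs_of_nonpos (by linarith)]; ring⟩
      · exact ⟨-1, by simp, by rw [abs_of_nonneg (by linarith)]; ring⟩
    obtain ⟨ε, hε, hxyε⟩ := hsign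
    -- bond by bond: the distance is convex, so it grows at least as for independent particles, and
    -- the exchange of `x` and `y`, which would decrease it by `2 |π x - π y|` in the linear
    -- comparison, leaves it unchanged; this surplus pays for the source
    have hbond : -gradProd r (u s) x y + G / 2 * (ε * (walkGen r π y - walkGen r π x))
        ≤ G / 2 * pairGen r (fun x y => |π x - π y|) x y := by
      simp only [gradProd, pairGen, walkGen_apply, ← Finset.sum_neg_distrib,
        ← Finset.sum_sub_distrib, ← Finset.sum_add_distrib, Finset.mul_sum]
      refine Finset.sum_le_sum fun i _ => Finset.sum_le_sum fun j _ => ?_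
      rcases eq_or_ne (r i j) 0 with hrij | hrij
      · simp [hrij]
      have hpos := hr i j
      have hconv (X Y : ℝ) : ε * (Y - X) ≤ |X - Y| := by
        refine (le_abs_self _).trans_eq ?_
        rw [abs_mul, hε, one_mul, abs_sub_comm]
      have hfix (h : Equiv.swap i j x = x ∨ Equiv.swap i j y = y) :
          (u s (Equiv.swap i j x) - u s x) * (u s (Equiv.swap i j y) - u s y) = 0 := by
        rcases h with h | h <;> rw [h] <;> simp
      have hmain (h : Equiv.swap i j x = x ∨ Equiv.swap i j y = y) :
          -(r i j * ((u s (Equiv.swap i j x) - u s x) * (u s (Equiv.swap i j y) - u s y)))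
            + G / 2 * (ε * (r i j * (π (Equiv.swap i j y) - π y)
              - r i j * (π (Equiv.swap i j x) - π x)))
          ≤ G / 2 * (r i j * (|π (Equiv.swap i j x) - π (Equiv.swap i j y)|
              - |π x - π y|)) := by
        rw [hfix h, hxyε]
        have := mul_le_mul_of_nonneg_left
          (hconv (π (Equiv.swap i j x)) (π (Equiv.swap i j y))) (mul_nonneg hpos hG0)
        linarith
      rcases swap_trichotomy i j hxy with h | h | ⟨h1, h2, h3⟩
      · exact hmain (Or.inl h)
      · exact hmain (Or.inr h)
      · rw [h1, h2, abs_sub_comm (π y), sub_self, mul_zero, mul_zero]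
        have hd : 1 ≤ ε * (π y - π x) := by
          rw [← hxyε]
          rcases h3 with ⟨rfl, rfl⟩ | ⟨rfl, rfl⟩
          · exact hπ _ _ hrij
          · rw [abs_sub_comm]; exact hπ _ _ hrij
        have hg : (u s x - u s y) ^ 2 ≤ G := by
          rcases h3 with ⟨rfl, rfl⟩ | ⟨rfl, rfl⟩
          · exact hG s has _ _ hrij
          · rw [← neg_sq, neg_sub]; exact hG s has _ _ hrij
        have h4 := mul_le_mul_of_nonneg_left hg hpos
        have h5 := mul_le_mul_of_nonneg_left hd (mul_nonneg hpos hG0)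
        nlinarith
    have hL : -(2 * η) ≤ ε * (walkGen r π y - walkGen r π x) := by
      have h1 : |ε * (walkGen r π y - walkGen r π x)| ≤ 2 * η := by
        rw [abs_mul, hε, one_mul]
        exact (abs_sub _ _).trans (by linarith [hη x, hη y])
      exact (abs_le.1 h1).1
    have hL' := mul_le_mul_of_nonneg_left hL (div_nonneg hG0 zero_le_two)
    rw [e]
    linarith
  · have h1 := h0 x y hxy
    have h2 : 0 ≤ G / 2 * (R - |π x - π y|) :=
      mul_nonneg (by linarith) (sub_nonneg.2 (hR x y))
    simp only [sub_self, mul_zero, add_zero]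
    linarith

end Interchange

/-! ### The stirring process with reservoirs -/

/-- The rates of the stirring process, carried by ordered pairs: each bond is listed once, and the
pairs that do not occur in `generator` have rate `0`. -/
noncomputable def rate (N M : ℕ) : Site N M → Site N M → ℝ
  | Sum.inl x, Sum.inl y => if (x : ℕ) + 1 = (y : ℕ) then 1 / 2 else 0
  | Sum.inl x, Sum.inr (Sum.inl _) => if (x : ℕ) = 1 then 1 / (2 * (M : ℝ)) else 0
  | Sum.inl x, Sum.inr (Sum.inr _) => if (x : ℕ) = N then 1 / (2 * (M : ℝ)) else 0
  | Sum.inr _, _ => 0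

theorem rate_nonneg (N M : ℕ) (i j : Site N M) : 0 ≤ rate N M i j := by
  rcases i with x | z <;> rcases j with y | (w | w) <;> simp only [rate] <;>
    first | exact le_rfl | (split_ifs <;> positivity)

theorem sum_rate (N M : ℕ) (H : Site N M → Site N M → ℝ) :
    ∑ i, ∑ j, rate N M i j * H i j
      = 1 / 2 * (∑ x : Channel N, ∑ y : Channel N,
          if (x : ℕ) + 1 = (y : ℕ) then H (chan x) (chan y) else 0)
        + 1 / (2 * (M : ℝ)) * (∑ x : Channel N, ∑ z : Fin M,
          if (x : ℕ) = 1 then H (chan x) (left z) else 0)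
        + 1 / (2 * (M : ℝ)) * (∑ x : Channel N, ∑ z : Fin M,
          if (x : ℕ) = N then H (chan x) (right z) else 0) := by
  simp only [Fintype.sum_sum_type, rate, zero_mul, Finset.sum_const_zero, add_zero,
    Finset.sum_add_distrib, Finset.mul_sum, mul_ite, mul_zero, ite_mul, chan, left, right]
  ring

theorem generator_apply (N M : ℕ) (f : Config N M → ℝ) (η : Config N M) :
    generator N M f η = ∑ i, ∑ j, rate N M i j * (f (exch i j η) - f η) := by
  have h (p : Prop) [Decidable p] (A : (Config N M → ℝ) →ₗ[ℝ] (Config N M → ℝ)) :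
      (if p then A else 0) f η = if p then A f η else 0 := by split_ifs <;> rfl
  rw [sum_rate]
  simp only [generator, LinearMap.add_apply, LinearMap.smul_apply, LinearMap.sum_apply,
    Pi.add_apply, Pi.smul_apply, Finset.sum_apply, h, smul_eq_mul, exchDiff, LinearMap.coe_mk,
    AddHom.coe_mk]

/-- The mean as a linear functional. -/
noncomputable def meanL {N M : ℕ} (μ : PMF (Config N M)) : (Config N M → ℝ) →ₗ[ℝ] ℝ where
  toFun := mean μ
  map_add' f g := by simp [mean, mul_add, Finset.sum_add_distrib]
  map_smul' c f := by
    simp only [mean, Finset.mul_sum, Pi.smul_apply, smul_eq_mul, RingHom.id_apply]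
    exact Finset.sum_congr rfl fun _ _ => by ring

/-- The expectation at a fixed time as a linear functional. -/
noncomputable def expectL {N M : ℕ} (μ : PMF (Config N M)) (s : ℝ) :
    (Config N M → ℝ) →ₗ[ℝ] ℝ :=
  (meanL μ).comp (semigroup N M s : (Config N M → ℝ) →ₗ[ℝ] (Config N M → ℝ))

theorem expectL_apply {N M : ℕ} (μ : PMF (Config N M)) (s : ℝ) (f : Config N M → ℝ) :
    expectL μ s f = expect μ s f := rfl

theorem expect_zero {N M : ℕ} (μ : PMF (Config N M)) (f : Config N M → ℝ) :
    expect μ 0 f = mean μ f := by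
  simp [expect, semigroup]

theorem hasDerivAt_expect {N M : ℕ} (μ : PMF (Config N M)) (f : Config N M → ℝ) (s : ℝ) :
    HasDerivAt (fun s => expect μ s f) (expect μ s (generator N M f)) s :=
  (LinearMap.toContinuousLinearMap (meanL μ)).hasFDerivAt.comp_hasDerivAt s
    (hasDerivAt_exp_smul_apply (LinearMap.toContinuousLinearMap (generator N M)) f s).2

theorem expect_generator {N M : ℕ} (μ : PMF (Config N M)) (s : ℝ) (f : Config N M → ℝ) :
    expect μ s (generator N M f)
      = ∑ i, ∑ j, rate N M i j * (expect μ s (fun η => f (exch i j η)) - expect μ s f) := by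
  have e : generator N M f = ∑ i, ∑ j, rate N M i j • ((fun η => f (exch i j η)) - f) := by
    funext η
    simp [generator_apply]
  rw [e]
  simp only [← expectL_apply, map_sum, map_smul, map_sub, smul_eq_mul]

/-- Self-duality for one particle: the mean occupation numbers solve the heat equation. -/
theorem isHeatFlow_expect_occ {N M : ℕ} (μ : PMF (Config N M)) :
    IsHeatFlow (rate N M) fun s x => expect μ s (occ x) := by
  refine fun s => hasDerivAt_pi.2 fun x => ?_
  rw [walkGen_apply]
  exact (hasDerivAt_expect μ (occ x) s).congr_deriv (expect_generator μ s (occ x))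

/-- The truncated two-point function at time `s`. -/
noncomputable def correlation {N M : ℕ} (μ : PMF (Config N M)) (s : ℝ) (x y : Site N M) : ℝ :=
  expect μ s (fun η => occ x η * occ y η) - expect μ s (occ x) * expect μ s (occ y)

/-- Self-duality for two particles: exchanging the contents of `i` and `j` in a configuration is the
same as exchanging the sites at which the occupation numbers are read. -/
theorem isCorrelationFlow_correlation {N M : ℕ} (μ : PMF (Config N M)) :
    IsCorrelationFlow (rate N M) (fun s x => expect μ s (occ x)) (correlation μ) := by
  intro s x y _
  have h1 := hasDerivAt_expect μ (fun η => occ x η * occ y η) s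
  have h2 := (isHeatFlow_expect_occ μ).hasDerivAt_apply s
  refine (h1.sub ((h2 x).mul (h2 y))).congr_deriv ?_
  rw [expect_generator]
  simp only [walkGen_apply, pairGen, gradProd, correlation, Finset.sum_mul, Finset.mul_sum,
    ← Finset.sum_add_distrib, ← Finset.sum_sub_distrib]
  refine Finset.sum_congr rfl fun i _ => Finset.sum_congr rfl fun j _ => ?_
  have e : (fun η : Config N M => occ x (exch i j η) * occ y (exch i j η))
      = fun η => occ (Equiv.swap i j x) η * occ (Equiv.swap i j y) η := rfl
  rw [e]
  ring

/-- The values of a function along the channel, as a function of `k : ℕ` with value `0` outside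
`1, …, N`. -/
def channelValue {N M : ℕ} (f : Site N M → ℝ) (k : ℕ) : ℝ :=
  if h : k ∈ Finset.Icc 1 N then f (chan ⟨k, h⟩) else 0

theorem channelValue_coe {N M : ℕ} (f : Site N M → ℝ) (x : Channel N) :
    channelValue f x = f (chan x) := by
  simp only [channelValue, x.2, dif_pos]

theorem sum_channel {N : ℕ} (h : ℕ → ℝ) : ∑ x : Channel N, h x = ∑ k ∈ Finset.Icc 1 N, h k :=
  Finset.sum_coe_sort (Finset.Icc 1 N) h

theorem sum_channel_succ {N : ℕ} (H : ℕ → ℕ → ℝ) :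
    ∑ x : Channel N, ∑ y : Channel N, (if (x : ℕ) + 1 = (y : ℕ) then H x y else 0)
      = ∑ k ∈ Finset.Ico 1 N, H k (k + 1) := by
  rw [Finset.sum_congr rfl fun (x : Channel N) _ =>
    sum_channel fun l => if (x : ℕ) + 1 = l then H x l else 0,
    sum_channel fun k => ∑ l ∈ Finset.Icc 1 N, if k + 1 = l then H k l else 0]
  simp only [Finset.sum_ite_eq]
  rw [← Finset.sum_filter]
  refine Finset.sum_congr (Finset.ext fun k => ?_) fun _ _ => rfl
  simp only [Finset.mem_filter, Finset.mem_Icc, Finset.mem_Ico]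
  omega

theorem dirichlet_rate {N M : ℕ} (hN : 1 ≤ N) (g f : Site N M → ℝ) :
    dirichlet (rate N M) g f
      = 1 / 2 * (∑ k ∈ Finset.Ico 1 N, (channelValue g k - channelValue g (k + 1))
            * (channelValue f k - channelValue f (k + 1)))
        + 1 / (2 * (M : ℝ)) * (∑ z : Fin M, (channelValue g 1 - g (left z))
            * (channelValue f 1 - f (left z)))
        + 1 / (2 * (M : ℝ)) * (∑ z : Fin M, (channelValue g N - g (right z))
            * (channelValue f N - f (right z))) := by
  rw [dirichlet, sum_rate]
  simp only [← channelValue_coe]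
  rw [sum_channel_succ fun k l => (channelValue g k - channelValue g l)
    * (channelValue f k - channelValue f l),
    sum_channel fun k => ∑ z : Fin M, if k = 1 then (channelValue g k - g (left z))
      * (channelValue f k - f (left z)) else 0,
    sum_channel fun k => ∑ z : Fin M, if k = N then (channelValue g k - g (right z))
      * (channelValue f k - f (right z)) else 0]
  congr 2
  · congr 1
    rw [Finset.sum_eq_single_of_mem 1 (by simp [hN])]
    · simp
    · intro k _ hk; simp [hk]
  · rw [Finset.sum_eq_single_of_mem N (by simp [hN])]
    · simp
    · intro k _ hk; simp [hk]

/-! ### One particle between the reservoirs -/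

/-- The position of a site on the segment `0, …, N + 1`: each reservoir is collapsed to one of the
end points. Bonds join sites at distance `1`. -/
def position {N M : ℕ} : Site N M → ℕ
  | Sum.inl x => x
  | Sum.inr (Sum.inl _) => 0
  | Sum.inr (Sum.inr _) => N + 1

theorem position_left {N M : ℕ} (z : Fin M) : position (left z : Site N M) = 0 := rfl

theorem position_right {N M : ℕ} (z : Fin M) : position (right z : Site N M) = N + 1 := rfl

theorem channelValue_comp_position {N M : ℕ} (h : ℕ → ℝ) {k : ℕ} (hk : k ∈ Finset.Icc 1 N) :
    channelValue (fun x : Site N M => h (position x)) k = h k := by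
  simp only [channelValue, hk, dif_pos, chan, position]

theorem position_le {N M : ℕ} (x : Site N M) : position x ≤ N + 1 := by
  rcases x with x | (z | z)
  · exact (Finset.mem_Icc.1 x.2).2.trans (Nat.le_succ N)
  · exact Nat.zero_le _
  · exact le_rfl

theorem abs_position_sub_le {N M : ℕ} (x y : Site N M) :
    |(position x : ℝ) - position y| ≤ N + 1 := by
  have hx : (position x : ℝ) ≤ N + 1 := by exact_mod_cast position_le x
  have hy : (position y : ℝ) ≤ N + 1 := by exact_mod_cast position_le y
  rw [abs_le]
  constructor <;> linarith [Nat.cast_nonneg (α := ℝ) (position x),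
    Nat.cast_nonneg (α := ℝ) (position y)]

theorem abs_position_sub_eq {N M : ℕ} {i j : Site N M} (h : rate N M i j ≠ 0) :
    |(position i : ℝ) - position j| = 1 := by
  rcases i with x | z
  · rcases j with y | (w | w) <;> simp only [rate] at h <;> split_ifs at h with h1 <;>
      simp only [position, ne_eq, not_true_eq_false] at h ⊢
    · rw [← h1]; simp
    · rw [h1]; simp
    · rw [h1]; simp
  · simp [rate] at h

/-- The position is harmonic in the channel: its Dirichlet form with `g` telescopes to the
reservoirs. -/
theorem dirichlet_position {N M : ℕ} (hN : 1 ≤ N) (hM : 1 ≤ M) (g : Site N M → ℝ) :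
    dirichlet (rate N M) g (fun x => (position x : ℝ))
      = 1 / (2 * (M : ℝ)) * (∑ z, g (right z) - ∑ z, g (left z)) := by
  have hM' : (M : ℝ) ≠ 0 := by positivity
  rw [dirichlet_rate hN]
  have h1 : ∑ k ∈ Finset.Ico 1 N, (channelValue g k - channelValue g (k + 1))
      * (channelValue (fun x : Site N M => (position x : ℝ)) k
        - channelValue (fun x : Site N M => (position x : ℝ)) (k + 1))
      = channelValue g N - channelValue g 1 := by
    rw [← Finset.sum_Ico_sub _ hN]
    refine Finset.sum_congr rfl fun k hk => ?_
    rw [Finset.mem_Ico] at hk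
    rw [channelValue_comp_position (fun k => (k : ℝ)) (Finset.mem_Icc.2 ⟨hk.1, hk.2.le⟩),
      channelValue_comp_position (fun k => (k : ℝ)) (Finset.mem_Icc.2 ⟨by omega, hk.2⟩)]
    push_cast; ring
  rw [h1, channelValue_comp_position (fun k => (k : ℝ)) (Finset.mem_Icc.2 ⟨le_rfl, hN⟩),
    channelValue_comp_position (fun k => (k : ℝ)) (Finset.mem_Icc.2 ⟨hN, le_rfl⟩)]
  simp only [left, right, position, Nat.cast_zero, Nat.cast_one, sub_zero, mul_one, Nat.cast_add,
    sub_add_cancel_left, mul_neg, Finset.sum_sub_distrib, Finset.sum_neg_distrib,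
    Finset.sum_const, Finset.card_univ, Fintype.card_fin, nsmul_eq_mul]
  field_simp
  ring

theorem abs_walkGen_position_le {N M : ℕ} (hN : 1 ≤ N) (hM : 1 ≤ M) (x : Site N M) :
    |walkGen (rate N M) (fun x => (position x : ℝ)) x| ≤ 1 / (2 * (M : ℝ)) := by
  have h := sum_mul_walkGen (rate N M) (fun y => if y = x then 1 else 0)
    (fun x => (position x : ℝ))
  simp only [ite_mul, one_mul, zero_mul, Finset.sum_ite_eq', Finset.mem_univ, if_true] at h
  rw [h, dirichlet_position hN hM, abs_neg, abs_mul, abs_of_nonneg (by positivity)]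
  refine mul_le_of_le_one_right (by positivity) ?_
  rcases x with x | (z | z) <;> simp [left, right]

theorem card_site (N M : ℕ) : Fintype.card (Site N M) = N + 2 * M := by
  simp only [Fintype.card_sum, Fintype.card_fin, Fintype.card_coe, Nat.card_Icc]
  omega

/-- For a function that is constant on each reservoir, the increment across a bond is twice the flux
through a cut between neighbouring positions, that is, the sum of `walkGen f` over one side of it;
the claim is Cauchy–Schwarz for this sum. -/
theorem sq_sub_le_of_rate_ne_zero {N M : ℕ} (hN : 1 ≤ N) {f : Site N M → ℝ} {cL cR : ℝ}
    (hL : ∀ z, f (left z) = cL) (hR : ∀ z, f (right z) = cR) {i j : Site N M}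
    (hij : rate N M i j ≠ 0) :
    (f i - f j) ^ 2 ≤ 4 * (N + 2 * M) * ∑ x, walkGen (rate N M) f x ^ 2 := by
  suffices h : ∃ g : Site N M → ℝ, (∀ x, g x ^ 2 ≤ 1) ∧
      dirichlet (rate N M) g f = 1 / 2 * (f i - f j) by
    obtain ⟨g, hg, hd⟩ := h
    have hcs := Finset.sum_mul_sq_le_sq_mul_sq Finset.univ g (walkGen (rate N M) f)
    have hg2 : ∑ x, g x ^ 2 ≤ N + 2 * M := by
      refine (Finset.sum_le_sum fun x _ => hg x).trans_eq ?_
      rw [Finset.sum_const, Finset.card_univ, card_site]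
      simp
    have := mul_le_mul_of_nonneg_right hg2
      (Finset.sum_nonneg fun x (_ : x ∈ Finset.univ) => sq_nonneg (walkGen (rate N M) f x))
    rw [sum_mul_walkGen, hd] at hcs
    nlinarith
  -- the flux through the cut between the positions `k` and `k + 1`
  have hcut (k : ℕ) (hk : k ≤ N) : dirichlet (rate N M)
      (fun x => if position x ≤ k then 1 else 0) f
      = 1 / 2 * (if k ∈ Finset.Ico 1 N then channelValue f k - channelValue f (k + 1) else 0)
        + 1 / (2 * (M : ℝ)) * (if k = 0 then M * (cL - channelValue f 1) else 0)
        + 1 / (2 * (M : ℝ)) * (if k = N then M * (channelValue f N - cR) else 0) := by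
    rw [dirichlet_rate hN, channelValue_comp_position (fun l => if l ≤ k then (1 : ℝ) else 0)
      (Finset.mem_Icc.2 ⟨le_rfl, hN⟩),
      channelValue_comp_position (fun l => if l ≤ k then (1 : ℝ) else 0)
      (Finset.mem_Icc.2 ⟨hN, le_rfl⟩)]
    simp only [hL, hR, position_left, position_right, zero_le, if_true,
      Finset.sum_const, Finset.card_univ, Fintype.card_fin, nsmul_eq_mul]
    refine congrArg₂ _ (congrArg₂ _ (congrArg _ ?_) (congrArg _ ?_)) (congrArg _ ?_)
    · rw [← Finset.sum_ite_eq (Finset.Ico 1 N) k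
        fun l => channelValue f l - channelValue f (l + 1)]
      refine Finset.sum_congr rfl fun l hl => ?_
      rw [Finset.mem_Ico] at hl
      rw [channelValue_comp_position (fun l => if l ≤ k then (1 : ℝ) else 0)
        (Finset.mem_Icc.2 ⟨hl.1, hl.2.le⟩),
        channelValue_comp_position (fun l => if l ≤ k then (1 : ℝ) else 0)
        (Finset.mem_Icc.2 ⟨by omega, hl.2⟩)]
      split_ifs <;> first | omega | simp
    · rcases Nat.eq_zero_or_pos k with rfl | h0
      · simp
      · simp [Nat.succ_le_iff.2 h0, h0.ne']
    · rcases hk.eq_or_lt with rfl | h0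
      · simp [mul_sub]
      · simp [h0.not_ge, h0.ne, hk.not_gt]
  have hind (k : ℕ) (x : Site N M) : (if position x ≤ k then (1 : ℝ) else 0) ^ 2 ≤ 1 := by
    split_ifs <;> norm_num
  have hM (z : Fin M) : (M : ℝ) ≠ 0 := by
    have := z.pos
    positivity
  rcases i with x | z
  · have hx := Finset.mem_Icc.1 x.2
    rcases j with y | (w | w) <;> simp only [rate] at hij <;> split_ifs at hij with h1
    · have hy := Finset.mem_Icc.1 y.2
      refine ⟨_, hind x, ?_⟩
      rw [hcut x hx.2, if_pos (Finset.mem_Ico.2 (by omega)), if_neg (by omega),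
        if_neg (by omega), h1, channelValue_coe, channelValue_coe, chan, chan]
      ring
    · exact absurd rfl hij
    · -- the pair of a left reservoir bond is listed against the direction of the positions
      refine ⟨fun x => -(if position x ≤ 0 then 1 else 0), fun x => by simpa using hind 0 x, ?_⟩
      have hneg : dirichlet (rate N M) (fun x => -(if position x ≤ 0 then 1 else 0)) f
          = -dirichlet (rate N M) (fun x => if position x ≤ 0 then 1 else 0) f := by
        rw [← sum_mul_walkGen, ← neg_neg (dirichlet _ _ _), ← sum_mul_walkGen]
        simp [Finset.sum_neg_distrib]
      have hL' := hL w
      have := hM w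
      rw [hneg, hcut 0 (Nat.zero_le _), if_neg (by simp), if_pos rfl, if_neg (by omega),
        show channelValue f 1 = f (chan x) by rw [← channelValue_coe f x, h1]]
      simp only [left, chan] at hL' ⊢
      rw [hL']
      field_simp
      ring
    · exact absurd rfl hij
    · refine ⟨_, hind N, ?_⟩
      have hR' := hR w
      have := hM w
      rw [hcut N le_rfl, if_neg (by simp), if_neg (by omega), if_pos rfl,
        show channelValue f N = f (chan x) by rw [← channelValue_coe f x, h1]]
      simp only [right, chan] at hR' ⊢
      rw [hR']
      field_simp
      ring
    · exact absurd rfl hij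
  · exact absurd rfl hij

/-- A discrete Sobolev inequality in the channel: some value is at most the root mean square, and
the oscillation is controlled by the Dirichlet form. -/
theorem sq_chan_le {N M : ℕ} (f : Site N M → ℝ) (x : Channel N) :
    f (chan x) ^ 2 ≤ 2 / N * ∑ y, f y ^ 2 + 4 * N * dirichlet (rate N M) f f := by
  have hx := Finset.mem_Icc.1 x.2
  have hN : 1 ≤ N := hx.1.trans hx.2
  have hN' : (0 : ℝ) < N := by positivity
  have hchan : ∑ y : Channel N, f (chan y) ^ 2 ≤ ∑ y, f y ^ 2 := by
    rw [Fintype.sum_sum_type (fun y => f y ^ 2)]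
    exact le_add_of_nonneg_right (Finset.sum_nonneg fun y _ => sq_nonneg _)
  obtain ⟨y, -, hy⟩ : ∃ y ∈ (Finset.univ : Finset (Channel N)),
      f (chan y) ^ 2 ≤ (∑ y, f y ^ 2) / N := by
    refine Finset.exists_le_of_sum_le ⟨x, Finset.mem_univ x⟩ (hchan.trans_eq ?_)
    rw [Finset.sum_const, Finset.card_univ, Fintype.card_coe, Nat.card_Icc, nsmul_eq_mul,
      Nat.add_sub_cancel]
    field_simp
  have henergy : ∑ k ∈ Finset.Ico 1 N, (channelValue f k - channelValue f (k + 1)) ^ 2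
      ≤ 2 * dirichlet (rate N M) f f := by
    rw [dirichlet_rate hN]
    have h1 : 0 ≤ 1 / (2 * (M : ℝ)) * (∑ z : Fin M, (channelValue f 1 - f (left z))
        * (channelValue f 1 - f (left z))) :=
      mul_nonneg (by positivity) (Finset.sum_nonneg fun z _ => mul_self_nonneg _)
    have h2 : 0 ≤ 1 / (2 * (M : ℝ)) * (∑ z : Fin M, (channelValue f N - f (right z))
        * (channelValue f N - f (right z))) :=
      mul_nonneg (by positivity) (Finset.sum_nonneg fun z _ => mul_self_nonneg _)
    simp only [pow_two]
    linarith
  have hosc (k l : ℕ) (hk : 1 ≤ k) (hkl : k ≤ l) (hl : l ≤ N) :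
      (channelValue f l - channelValue f k) ^ 2 ≤ N * (2 * dirichlet (rate N M) f f) := by
    rw [← Finset.sum_Ico_sub _ hkl]
    refine sq_sum_le_card_mul_sum_sq.trans ?_
    refine mul_le_mul (by rw [Nat.card_Ico]; exact_mod_cast (by omega)) (le_trans ?_ henergy)
      (Finset.sum_nonneg fun _ _ => sq_nonneg _) hN'.le
    refine (Finset.sum_le_sum_of_subset_of_nonneg (Finset.Ico_subset_Ico hk hl)
      fun _ _ _ => sq_nonneg _).trans_eq (Finset.sum_congr rfl fun _ _ => by ring)
  have hxy : (f (chan x) - f (chan y)) ^ 2 ≤ N * (2 * dirichlet (rate N M) f f) := by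
    have hy' := Finset.mem_Icc.1 y.2
    rw [← channelValue_coe f x, ← channelValue_coe f y]
    rcases le_total (x : ℕ) y with h | h
    · rw [← neg_sq, neg_sub]; exact hosc x y hx.1 h hy'.2
    · exact hosc y x hy'.1 h hx.2
  have h2 : 2 / (N : ℝ) * ∑ y, f y ^ 2 = 2 * ((∑ y, f y ^ 2) / N) := by ring
  nlinarith [sq_nonneg (f (chan x) - 2 * f (chan y))]

/-! ### The initial law -/

theorem mean_comp {N M : ℕ} {α : Type*} [Fintype α] (μ : PMF (Config N M)) (g : Config N M → α)
    (f : α → ℝ) : mean μ (fun η => f (g η)) = ∑ ζ, ((μ.map g) ζ).toReal * f ζ := by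
  classical
  have h (ζ : α) : ((μ.map g) ζ).toReal = ∑ η, if ζ = g η then (μ η).toReal else 0 := by
    rw [PMF.map_apply, tsum_fintype, ENNReal.toReal_sum]
    · exact Finset.sum_congr rfl fun η _ => by split_ifs <;> simp
    · intro η _
      split_ifs
      · exact μ.apply_ne_top η
      · exact ENNReal.zero_ne_top
  simp only [h, Finset.sum_mul, ite_mul, zero_mul]
  rw [Finset.sum_comm]
  simp [mean]

theorem sum_toReal_eq_one {α : Type*} [Fintype α] (ν : PMF α) : ∑ ζ, (ν ζ).toReal = 1 := by
  rw [← ENNReal.toReal_sum fun ζ _ => ν.apply_ne_top ζ,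
    ← (tsum_fintype (fun ζ => ν ζ) : ∑' ζ, ν ζ = _), ν.tsum_coe, ENNReal.toReal_one]

/-- The occupation number of a site of a reservoir. -/
def bit {M : ℕ} (z : Fin M) (ζ : Fin M → Bool) : ℝ := if ζ z = true then 1 else 0

theorem bit_mul_self {M : ℕ} (z : Fin M) (ζ : Fin M → Bool) : bit z ζ * bit z ζ = bit z ζ := by
  unfold bit; split_ifs <;> simp

theorem sum_bit {M : ℕ} (ζ : Fin M → Bool) : ∑ z, bit z ζ = count ζ := by
  simp [bit, count]

theorem count_comp {M : ℕ} (σ : Equiv.Perm (Fin M)) (ζ : Fin M → Bool) :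
    count (fun z => ζ (σ z)) = count ζ := by
  have h : (count (fun z => ζ (σ z)) : ℝ) = count ζ := by
    rw [← sum_bit, ← sum_bit]
    exact Equiv.sum_comp σ fun z => bit z ζ
  exact_mod_cast h

theorem IsUniform.apply_comp {M n : ℕ} {ν : PMF (Fin M → Bool)} (h : IsUniform n ν)
    (σ : Equiv.Perm (Fin M)) (ζ : Fin M → Bool) : ν (fun z => ζ (σ z)) = ν ζ := by
  by_cases hn : count ζ = n
  · exact h.uniform _ _ ((count_comp σ ζ).trans hn) hn
  · have h1 : ν ζ = 0 := by_contra fun h0 => hn (h.count_eq ζ h0)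
    have h2 : ν (fun z => ζ (σ z)) = 0 :=
      by_contra fun h0 => hn ((count_comp σ ζ).symm.trans (h.count_eq _ h0))
    rw [h1, h2]

theorem IsUniform.sum_comp {M n : ℕ} {ν : PMF (Fin M → Bool)} (h : IsUniform n ν)
    (σ : Equiv.Perm (Fin M)) (f : (Fin M → Bool) → ℝ) :
    ∑ ζ, (ν ζ).toReal * f (fun z => ζ (σ z)) = ∑ ζ, (ν ζ).toReal * f ζ := by
  rw [← Equiv.sum_comp (Equiv.arrowCongr σ.symm (Equiv.refl Bool)) fun ζ => (ν ζ).toReal * f ζ]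
  refine Finset.sum_congr rfl fun ζ _ => ?_
  have e : Equiv.arrowCongr σ.symm (Equiv.refl Bool) ζ = fun z => ζ (σ z) := rfl
  rw [e, h.apply_comp σ ζ]

theorem IsUniform.sum_count_mul {M n : ℕ} {ν : PMF (Fin M → Bool)} (h : IsUniform n ν)
    (f : (Fin M → Bool) → ℝ) :
    ∑ z, ∑ ζ, (ν ζ).toReal * (f ζ * bit z ζ) = n * ∑ ζ, (ν ζ).toReal * f ζ := by
  rw [Finset.sum_comm, Finset.mul_sum]
  refine Finset.sum_congr rfl fun ζ _ => ?_
  rw [← Finset.mul_sum, ← Finset.mul_sum, sum_bit]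
  by_cases h0 : ν ζ = 0
  · simp [h0]
  · rw [h.count_eq ζ h0]; ring

/-- Under the uniform law with `n` particles all sites have the same mean `m`, and two distinct
sites have the covariance `-m (1 - m) / (M - 1)`: by exchangeability all covariances agree, and the
total number of particles does not fluctuate. -/
theorem IsUniform.exists_mean {M n : ℕ} (hM : 2 ≤ M) {ν : PMF (Fin M → Bool)}
    (h : IsUniform n ν) : ∃ m : ℝ, 0 ≤ m ∧ m ≤ 1 ∧ (∀ z, ∑ ζ, (ν ζ).toReal * bit z ζ = m) ∧
      ∀ z z', z ≠ z' →
        |∑ ζ, (ν ζ).toReal * (bit z ζ * bit z' ζ) - m * m| ≤ 1 / ((M : ℝ) - 1) := by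
  have hM1 : (1 : ℝ) < M := by exact_mod_cast hM
  let z₀ : Fin M := ⟨0, by omega⟩
  have hm (z : Fin M) : ∑ ζ, (ν ζ).toReal * bit z ζ = ∑ ζ, (ν ζ).toReal * bit z₀ ζ := by
    rw [← h.sum_comp (Equiv.swap z z₀) (bit z₀)]
    simp [bit]
  have hm0 : 0 ≤ ∑ ζ, (ν ζ).toReal * bit z₀ ζ := Finset.sum_nonneg fun ζ _ =>
    mul_nonneg ENNReal.toReal_nonneg (by unfold bit; split_ifs <;> norm_num)
  have hm1 : ∑ ζ, (ν ζ).toReal * bit z₀ ζ ≤ 1 := by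
    rw [← sum_toReal_eq_one ν]
    refine Finset.sum_le_sum fun ζ _ => mul_le_of_le_one_right ENNReal.toReal_nonneg ?_
    unfold bit; split_ifs <;> norm_num
  have hn : M * ∑ ζ, (ν ζ).toReal * bit z₀ ζ = (n : ℝ) := by
    have := h.sum_count_mul fun _ => 1
    simp only [one_mul, mul_one, sum_toReal_eq_one, hm, Finset.sum_const, Finset.card_univ,
      Fintype.card_fin, nsmul_eq_mul] at this
    exact this
  refine ⟨_, hm0, hm1, hm, fun z z' hzz' => ?_⟩
  have hc (w : Fin M) (hw : w ≠ z) : ∑ ζ, (ν ζ).toReal * (bit z ζ * bit w ζ)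
      = ∑ ζ, (ν ζ).toReal * (bit z ζ * bit z' ζ) := by
    rw [← h.sum_comp (Equiv.swap w z') fun ζ => bit z ζ * bit z' ζ]
    simp [bit, Equiv.swap_apply_of_ne_of_ne hw.symm hzz']
  have hsum := h.sum_count_mul (bit z)
  rw [← Finset.add_sum_erase _ _ (Finset.mem_univ z),
    Finset.sum_congr rfl fun w hw => hc w (Finset.ne_of_mem_erase hw), Finset.sum_const,
    Finset.card_erase_of_mem (Finset.mem_univ z), Finset.card_univ, Fintype.card_fin,
    nsmul_eq_mul, Nat.cast_sub (by omega)] at hsum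
  simp only [bit_mul_self, hm, Nat.cast_one] at hsum
  rw [← hn] at hsum
  set m := ∑ ζ, (ν ζ).toReal * bit z₀ ζ
  set c := ∑ ζ, (ν ζ).toReal * (bit z ζ * bit z' ζ)
  have key : (M - 1) * (c - m * m) = -(m * (1 - m)) := by linear_combination hsum
  rw [le_div_iff₀ (by linarith), ← abs_of_pos (sub_pos.2 hM1), ← abs_mul, mul_comm, key, abs_neg,
    abs_of_nonneg (mul_nonneg hm0 (by linarith))]
  nlinarith

theorem mean_occ_left {N M : ℕ} (μ : PMF (Config N M)) (z : Fin M) :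
    mean μ (occ (left z)) = ∑ ζ, ((μ.map leftPart) ζ).toReal * bit z ζ :=
  mean_comp μ leftPart (bit z)

theorem mean_occ_right {N M : ℕ} (μ : PMF (Config N M)) (z : Fin M) :
    mean μ (occ (right z)) = ∑ ζ, ((μ.map rightPart) ζ).toReal * bit z ζ :=
  mean_comp μ rightPart (bit z)

theorem mean_occ_mem_Icc {N M : ℕ} (μ : PMF (Config N M)) (x : Site N M) :
    mean μ (occ x) ∈ Set.Icc (0 : ℝ) 1 := by
  have h0 (η : Config N M) : 0 ≤ occ x η := by unfold occ; split_ifs <;> norm_num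
  have h1 (η : Config N M) : occ x η ≤ 1 := by unfold occ; split_ifs <;> norm_num
  refine ⟨Finset.sum_nonneg fun η _ => mul_nonneg ENNReal.toReal_nonneg (h0 η), ?_⟩
  rw [← sum_toReal_eq_one μ]
  exact Finset.sum_le_sum fun η _ => mul_le_of_le_one_right ENNReal.toReal_nonneg (h1 η)

theorem IsInitialLaw.exists_reservoir_means {N : ℕ} (hN : 2 ≤ N) {u₀ : ℝ → ℝ} {nL nR : ℕ}
    {μ : PMF (Config N N)} (h : IsInitialLaw N u₀ nL nR μ) :
    ∃ ρL ∈ Set.Icc (0 : ℝ) 1, ∃ ρR ∈ Set.Icc (0 : ℝ) 1,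
      (∀ z, mean μ (occ (left z)) = ρL) ∧ (∀ z, mean μ (occ (right z)) = ρR) := by
  obtain ⟨m, h0, h1, hm, -⟩ := h.left_uniform.exists_mean hN
  obtain ⟨m', h0', h1', hm', -⟩ := h.right_uniform.exists_mean hN
  exact ⟨m, ⟨h0, h1⟩, m', ⟨h0', h1'⟩, fun z => by rw [mean_occ_left, hm],
    fun z => by rw [mean_occ_right, hm']⟩

theorem IsInitialLaw.abs_correlation_zero_le {N : ℕ} (hN : 2 ≤ N) {u₀ : ℝ → ℝ} {nL nR : ℕ}
    {μ : PMF (Config N N)} (h : IsInitialLaw N u₀ nL nR μ) {x y : Site N N} (hxy : x ≠ y) :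
    |correlation μ 0 x y| ≤ 1 / ((N : ℝ) - 1) := by
  simp only [correlation, expect_zero]
  have hN1 : (1 : ℝ) < N := by exact_mod_cast hN
  by_cases hs : SameReservoir x y
  · rcases hs with ⟨z, z', rfl, rfl⟩ | ⟨z, z', rfl, rfl⟩
    · obtain ⟨m, -, -, hm, hc⟩ := h.left_uniform.exists_mean hN
      rw [mean_occ_left, mean_occ_left, hm, hm]
      have e := mean_comp μ leftPart fun ζ => bit z ζ * bit z' ζ
      exact (congrArg (fun a => |a - m * m|) e).trans_le
        (hc z z' fun hz => hxy (by rw [hz]))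
    · obtain ⟨m, -, -, hm, hc⟩ := h.right_uniform.exists_mean hN
      rw [mean_occ_right, mean_occ_right, hm, hm]
      have e := mean_comp μ rightPart fun ζ => bit z ζ * bit z' ζ
      exact (congrArg (fun a => |a - m * m|) e).trans_le
        (hc z z' fun hz => hxy (by rw [hz]))
  · rw [h.uncorrelated x y hxy hs, sub_self, abs_zero]
    exact div_nonneg zero_le_one (by linarith)

/-! ### The one-point function in the reservoirs -/

theorem walkGen_left {N M : ℕ} (hN : 1 ≤ N) (f : Site N M → ℝ) (z : Fin M) :
    walkGen (rate N M) f (left z) = 1 / (2 * (M : ℝ)) * (channelValue f 1 - f (left z)) := by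
  have h := sum_mul_walkGen (rate N M) (fun y => if y = left z then 1 else 0) f
  simp only [ite_mul, one_mul, zero_mul, Finset.sum_ite_eq', Finset.mem_univ, if_true] at h
  rw [h, dirichlet_rate hN]
  simp [channelValue, chan, left, right]
  ring

theorem walkGen_right {N M : ℕ} (hN : 1 ≤ N) (f : Site N M → ℝ) (z : Fin M) :
    walkGen (rate N M) f (right z) = 1 / (2 * (M : ℝ)) * (channelValue f N - f (right z)) := by
  have h := sum_mul_walkGen (rate N M) (fun y => if y = right z then 1 else 0) f
  simp only [ite_mul, one_mul, zero_mul, Finset.sum_ite_eq', Finset.mem_univ, if_true] at h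
  rw [h, dirichlet_rate hN]
  simp [channelValue, chan, left, right]
  ring

/-- If the generator contracts the difference of the values at `x` and `y` for every function, then
equal values at `x` and `y` stay equal. -/
theorem IsHeatFlow.eq_of_relaxation {ι : Type*} [Fintype ι] [DecidableEq ι] {r : ι → ι → ℝ}
    {u : ℝ → ι → ℝ} (hu : IsHeatFlow r u) {x y : ι} {c : ℝ} (hc : 0 ≤ c)
    (hL : ∀ f, walkGen r f x - walkGen r f y = -(c * (f x - f y))) {a s : ℝ} (hs : a ≤ s)
    (h0 : u a x = u a y) : u s x = u s y := by
  have key := le_of_hasDerivAt_nonpos (f := fun s => (u s x - u s y) ^ 2) hs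
    (fun s => ((hu.hasDerivAt_apply s x).sub (hu.hasDerivAt_apply s y)).fun_pow 2) ?_
  · rw [h0, sub_self] at key
    have : (u s x - u s y) ^ 2 = 0 := le_antisymm (by simpa using key) (sq_nonneg _)
    exact sub_eq_zero.1 (by simpa using this)
  · intro s _
    rw [hL]
    push_cast
    have := mul_nonneg hc (sq_nonneg (u s x - u s y))
    simp only [pow_one, Pi.sub_apply]
    nlinarith

theorem IsHeatFlow.left_eq {N M : ℕ} (hN : 1 ≤ N) {u : ℝ → Site N M → ℝ}
    (hu : IsHeatFlow (rate N M) u) {a s : ℝ} (hs : a ≤ s) {z z' : Fin M}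
    (h0 : u a (left z) = u a (left z')) : u s (left z) = u s (left z') :=
  hu.eq_of_relaxation (c := 1 / (2 * (M : ℝ))) (by positivity)
    (fun f => by rw [walkGen_left hN, walkGen_left hN]; ring) hs h0

theorem IsHeatFlow.right_eq {N M : ℕ} (hN : 1 ≤ N) {u : ℝ → Site N M → ℝ}
    (hu : IsHeatFlow (rate N M) u) {a s : ℝ} (hs : a ≤ s) {z z' : Fin M}
    (h0 : u a (right z) = u a (right z')) : u s (right z) = u s (right z') :=
  hu.eq_of_relaxation (c := 1 / (2 * (M : ℝ))) (by positivity)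
    (fun f => by rw [walkGen_right hN, walkGen_right hN]; ring) hs h0

/-! ### Quantitative lower bound for the correlations -/

/-- The lower bound in two phases. Until the time `S` the correlations are bounded by the variance
of the initial profile under the walk, which is then transported to the time `T` (this is `A`,
bounded by the energy dissipated until `S`, hence by the distance to a smooth `f`); after `S` the
gradient of the one-point function is of order `N / S`, and
`IsCorrelationFlow.neg_le_of_gradient_le` applies. -/
theorem neg_correlation_le {N : ℕ} (hN : 2 ≤ N) {u₀ : ℝ → ℝ} {nL nR : ℕ}
    {μ : PMF (Config N N)} (h : IsInitialLaw N u₀ nL nR μ) {S T : ℝ} (hS : 0 < S) (hST : S < T)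
    (f : Site N N → ℝ) {x y : Channel N} (hxy : x ≠ y) :
    ∃ A : ℝ, A ^ 2 ≤ (2 / N + 2 * N / (T - S)) *
        (2 * S * dirichlet (rate N N) f f + 2 * ∑ z, (mean μ (occ z) - f z) ^ 2) ∧
      -correlation μ T (chan x) (chan y)
        ≤ 1 / ((N : ℝ) - 1) + A + 9 * N ^ 2 / S ^ 2 * (N + 1 + (T - S) / N) := by
  have hN0 : (0 : ℝ) < N := by positivity
  have hN1 : 1 ≤ N := by omega
  have hr := rate_nonneg N N
  set u : ℝ → Site N N → ℝ := fun s x => expect μ s (occ x) with hudef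
  have hu : IsHeatFlow (rate N N) u := isHeatFlow_expect_occ μ
  have hv : IsCorrelationFlow (rate N N) u (correlation μ) := isCorrelationFlow_correlation μ
  have hu0 (z : Site N N) : u 0 z = mean μ (occ z) := expect_zero μ _
  have hu0' (z : Site N N) : u 0 z ^ 2 ≤ 1 := by
    rw [hu0]
    exact pow_le_one₀ (mean_occ_mem_Icc μ z).1 (mean_occ_mem_Icc μ z).2
  obtain ⟨p, hp, hp0⟩ := exists_isHeatFlow (rate N N) 0 fun z => u 0 z ^ 2
  have hup (z : Site N N) : u S z ^ 2 ≤ p S z :=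
    hu.sq_le hr hp (fun z => (congrFun hp0 z).ge) hS.le z
  have hp1 (z : Site N N) : p S z ≤ 1 :=
    hp.le_of_le hr (fun z => (congrFun hp0 z).trans_le (hu0' z)) hS.le z
  obtain ⟨Φ, hΦ, hΦS⟩ := exists_isHeatFlow (rate N N) S fun z => p S z - u S z ^ 2
  refine ⟨Φ T (chan x), ?_, ?_⟩
  · -- the variances after the first phase are in `[0, 1]`, so that their `ℓ²` norm is
    -- controlled by their sum, the energy that the one-point function has dissipated
    have hΦ2 : ∑ z, Φ S z ^ 2 ≤ ∑ z, u 0 z ^ 2 - ∑ z, u S z ^ 2 := by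
      have e : ∑ z, u 0 z ^ 2 = ∑ z, p S z := by rw [hp.sum_eq S 0, hp0]
      rw [e, ← Finset.sum_sub_distrib]
      refine Finset.sum_le_sum fun z _ => ?_
      rw [hΦS]
      have h1 : 0 ≤ p S z - u S z ^ 2 := sub_nonneg.2 (hup z)
      have h2 : p S z - u S z ^ 2 ≤ 1 := by linarith [hp1 z, sq_nonneg (u S z)]
      exact (pow_two _).trans_le (mul_le_of_le_one_left h1 h2)
    have hdis := hu.sum_sq_sub_le hr hS.le f
    simp only [sub_zero, hu0] at hdis hΦ2
    have hTS : 0 < T - S := sub_pos.2 hST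
    have hen := hΦ.energy_le hr hST.le
    have hsup := sq_chan_le (Φ T) x
    have hD := dirichlet_self_nonneg hr (Φ T)
    have hZ : 0 ≤ 2 * (T - S) ^ 2 * ∑ z, walkGen (rate N N) (Φ T) z ^ 2 := by positivity
    have hΦT : 0 ≤ ∑ z, Φ T z ^ 2 := Finset.sum_nonneg fun _ _ => sq_nonneg _
    have hD' : 0 ≤ 2 * (T - S) * dirichlet (rate N N) (Φ T) (Φ T) := by positivity
    have h1 : 2 / N * ∑ z, Φ T z ^ 2 ≤ 2 / N * ∑ z, Φ S z ^ 2 :=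
      mul_le_mul_of_nonneg_left (by linarith) (by positivity)
    have h2 : 4 * N * dirichlet (rate N N) (Φ T) (Φ T)
        ≤ 2 * N / (T - S) * ∑ z, Φ S z ^ 2 := by
      calc 4 * N * dirichlet (rate N N) (Φ T) (Φ T)
          = 2 * N / (T - S) * (2 * (T - S) * dirichlet (rate N N) (Φ T) (Φ T)) := by
            field_simp; ring
        _ ≤ _ := mul_le_mul_of_nonneg_left (by linarith) (by positivity)
    calc Φ T (chan x) ^ 2 ≤ (2 / N + 2 * N / (T - S)) * ∑ z, Φ S z ^ 2 := by linarith
      _ ≤ _ := mul_le_mul_of_nonneg_left (by linarith) (by positivity)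
  · have h0 (x y : Site N N) (hxy : x ≠ y) : -correlation μ 0 x y ≤ 1 / ((N : ℝ) - 1) :=
      (neg_le_abs _).trans (h.abs_correlation_zero_le hN hxy)
    have hphase (x y : Site N N) (hxy : x ≠ y) :
        -correlation μ S x y ≤ 1 / ((N : ℝ) - 1) + Φ S x := by
      rw [hΦS]
      exact hv.neg_le_variance hr hu hp (fun z => (congrFun hp0 z).ge) h0 hS.le hxy
    obtain ⟨ρL, -, ρR, -, hρL, hρR⟩ := h.exists_reservoir_means hN
    have hgrad (s : ℝ) (hs : S ≤ s) (i j : Site N N) (hij : rate N N i j ≠ 0) :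
        (u s i - u s j) ^ 2 ≤ 18 * N ^ 2 / S ^ 2 := by
      have hs0 : 0 < s := hS.trans_le hs
      let z₀ : Fin N := ⟨0, by omega⟩
      have hb := sq_sub_le_of_rate_ne_zero hN1 (f := u s) (cL := u s (left z₀))
        (cR := u s (right z₀))
        (fun z => hu.left_eq hN1 hs0.le (by rw [hu0, hu0, hρL, hρL]))
        (fun z => hu.right_eq hN1 hs0.le (by rw [hu0, hu0, hρR, hρR])) hij
      have hen := hu.energy_le hr hs0.le
      have hsum : ∑ z, u 0 z ^ 2 ≤ 3 * N := by
        refine (Finset.sum_le_sum fun z _ => hu0' z).trans_eq ?_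
        rw [Finset.sum_const, Finset.card_univ, card_site, nsmul_eq_mul]
        push_cast; ring
      have hD' : 0 ≤ 2 * s * dirichlet (rate N N) (u s) (u s) :=
        mul_nonneg (by positivity) (dirichlet_self_nonneg hr (u s))
      have hZ : 0 ≤ ∑ z, walkGen (rate N N) (u s) z ^ 2 :=
        Finset.sum_nonneg fun _ _ => sq_nonneg _
      have hu2 : 0 ≤ ∑ z, u s z ^ 2 := Finset.sum_nonneg fun _ _ => sq_nonneg _
      rw [sub_zero] at hen
      have hSs : S ^ 2 ≤ s ^ 2 := pow_le_pow_left₀ hS.le hs 2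
      have hZS : S ^ 2 * ∑ z, walkGen (rate N N) (u s) z ^ 2 ≤ 3 / 2 * N := by
        have := mul_le_mul_of_nonneg_right hSs hZ
        linarith
      rw [le_div_iff₀ (by positivity)]
      calc (u s i - u s j) ^ 2 * S ^ 2
          ≤ (4 * (N + 2 * N) * ∑ z, walkGen (rate N N) (u s) z ^ 2) * S ^ 2 :=
            mul_le_mul_of_nonneg_right hb (by positivity)
        _ = 12 * N * (S ^ 2 * ∑ z, walkGen (rate N N) (u s) z ^ 2) := by ring
        _ ≤ 12 * N * (3 / 2 * N) := mul_le_mul_of_nonneg_left hZS (by positivity)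
        _ = 18 * N ^ 2 := by ring
    have hfin := hv.neg_le_of_gradient_le hr hΦ (fun i j hij => (abs_position_sub_eq hij).ge)
      abs_position_sub_le (abs_walkGen_position_le hN1 hN1) hgrad hphase hST.le
      (x := chan x) (y := chan y) (fun he => hxy (Sum.inl_injective he)) (by positivity)
    refine hfin.trans_eq ?_
    field_simp
    ring

/-! ### Smooth approximation of the initial profile -/

theorem dirichlet_comp_position_le {N : ℕ} (hN : 1 ≤ N) {h : ℕ → ℝ} {b : ℝ}
    (hb : ∀ k, (h k - h (k + 1)) ^ 2 ≤ b) :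
    dirichlet (rate N N) (fun x => h (position x)) (fun x => h (position x)) ≤ N * b := by
  have hN0 : (0 : ℝ) < N := by positivity
  have hN1 : (1 : ℝ) ≤ N := by exact_mod_cast hN
  have hb0 : 0 ≤ b := (sq_nonneg _).trans (hb 0)
  rw [dirichlet_rate hN, channelValue_comp_position h (Finset.mem_Icc.2 ⟨le_rfl, hN⟩),
    channelValue_comp_position h (Finset.mem_Icc.2 ⟨hN, le_rfl⟩)]
  simp only [position_left, position_right, ← pow_two, Finset.sum_const, Finset.card_univ,
    Fintype.card_fin, nsmul_eq_mul]
  have h1 : ∑ k ∈ Finset.Ico 1 N, (channelValue (fun x : Site N N => h (position x)) k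
      - channelValue (fun x : Site N N => h (position x)) (k + 1)) ^ 2 ≤ (N - 1) * b := by
    have := Finset.sum_le_card_nsmul (Finset.Ico 1 N) (fun k =>
      (channelValue (fun x : Site N N => h (position x)) k
      - channelValue (fun x : Site N N => h (position x)) (k + 1)) ^ 2) b fun k hk => by
        rw [Finset.mem_Ico] at hk
        rw [channelValue_comp_position h (Finset.mem_Icc.2 ⟨hk.1, hk.2.le⟩),
          channelValue_comp_position h (Finset.mem_Icc.2 ⟨by omega, hk.2⟩)]
        exact hb k
    rwa [Nat.card_Ico, nsmul_eq_mul, Nat.cast_sub hN, Nat.cast_one] at this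
  have h2 : (h 1 - h 0) ^ 2 ≤ b := by rw [← neg_sq, neg_sub]; exact hb 0
  have h3 := hb N
  have e (c : ℝ) : 1 / (2 * (N : ℝ)) * (N * c) = c / 2 := by field_simp
  rw [e, e]
  nlinarith

/-- A Lipschitz function with prescribed values at `0` and `1` that agrees with `u₀` away from the
end points. The Lipschitz constant does not depend on the prescribed values, which are the reservoir
densities and may vary with `N`. -/
theorem exists_lipschitz_interpolation {u₀ : ℝ → ℝ} (hu₀ : ContDiffOn ℝ 1 u₀ (Set.Ioo 0 1))
    (hrange : ∀ r ∈ Set.Icc (0 : ℝ) 1, u₀ r ∈ Set.Icc (0 : ℝ) 1) {κ : ℝ} (hκ : 0 < κ)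
    (hκ' : κ < 1 / 2) :
    ∃ K : NNReal, ∀ ρL ∈ Set.Icc (0 : ℝ) 1, ∀ ρR ∈ Set.Icc (0 : ℝ) 1, ∃ F : ℝ → ℝ,
      LipschitzWith K F ∧ F 0 = ρL ∧ F 1 = ρR ∧
      (∀ r ∈ Set.Icc (0 : ℝ) 1, F r ∈ Set.Icc (0 : ℝ) 1) ∧
      ∀ r ∈ Set.Icc κ (1 - κ), F r = u₀ r := by
  have hab : κ ≤ 1 - κ := by linarith
  have hsub : Set.Icc κ (1 - κ) ⊆ Set.Ioo 0 1 := fun r hr =>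
    ⟨hκ.trans_le hr.1, by linarith [hr.2]⟩
  obtain ⟨K₀, hK₀⟩ : ∃ K, LipschitzOnWith K u₀ (Set.Icc κ (1 - κ)) := by
    have hd : ContinuousOn (deriv u₀) (Set.Icc κ (1 - κ)) :=
      (hu₀.continuousOn_deriv_of_isOpen isOpen_Ioo le_rfl).mono hsub
    obtain ⟨C, hC⟩ := isCompact_Icc.exists_bound_of_continuousOn hd
    refine ⟨C.toNNReal, (convex_Icc κ (1 - κ)).lipschitzOnWith_of_nnnorm_deriv_le
      (fun r hr => (hu₀.differentiableOn one_ne_zero).differentiableAt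
        (isOpen_Ioo.mem_nhds (hsub hr))) fun r hr => ?_⟩
    rw [← NNReal.coe_le_coe, coe_nnnorm]
    exact (hC r hr).trans (Real.le_coe_toNNReal C)
  obtain ⟨G, hG, hGr, hGu⟩ : ∃ G : ℝ → ℝ, LipschitzWith K₀ G ∧
      (∀ r, G r ∈ Set.Icc (0 : ℝ) 1) ∧ ∀ r ∈ Set.Icc κ (1 - κ), G r = u₀ r := by
    refine ⟨fun r => u₀ (Set.projIcc κ (1 - κ) hab r), ?_, fun r => ?_, fun r hr => ?_⟩
    · have h := hK₀.to_restrict.comp (LipschitzWith.projIcc hab)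
      rw [mul_one] at h
      exact h
    · exact hrange _ (Set.Ioo_subset_Icc_self (hsub (Set.projIcc κ (1 - κ) hab r).2))
    · simp only [Set.projIcc_of_mem hab hr]
  let κ' : NNReal := ⟨κ⁻¹, inv_nonneg.2 hκ.le⟩
  refine ⟨max κ' K₀, fun ρL hρL ρR hρR => ?_⟩
  have hlin (c d : ℝ) (hd : |d| = κ⁻¹) : LipschitzWith κ' fun r => c + d * r :=
    LipschitzWith.of_dist_le_mul fun r s => by
      rw [Real.dist_eq, Real.dist_eq, add_sub_add_left_eq_sub, ← mul_sub, abs_mul, hd]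
      exact le_rfl
  have habs : |κ⁻¹| = κ⁻¹ := abs_of_pos (inv_pos.2 hκ)
  have habs' : |-κ⁻¹| = κ⁻¹ := by rw [abs_neg, habs]
  -- a window around the value at an end, which opens with slope `κ⁻¹`, cuts off the function
  refine ⟨fun r => max ((ρR - κ⁻¹) + κ⁻¹ * r) (min ((ρR + κ⁻¹) + -κ⁻¹ * r)
    (max (ρL + -κ⁻¹ * r) (min (ρL + κ⁻¹ * r) (G r)))), ?_, ?_, ?_, ?_, ?_⟩
  · have h := (hlin (ρR - κ⁻¹) κ⁻¹ habs).max ((hlin (ρR + κ⁻¹) (-κ⁻¹) habs').min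
      ((hlin ρL (-κ⁻¹) habs').max ((hlin ρL κ⁻¹ habs).min hG)))
    simpa using h
  · have h1 : 1 ≤ κ⁻¹ := (one_le_inv₀ hκ).2 (by linarith)
    simp only [mul_zero, add_zero]
    rw [max_eq_left (min_le_left _ _), min_eq_right (by linarith [hρL.2, hρR.1]),
      max_eq_right (by linarith [hρL.1, hρR.2])]
  · simp only [mul_one, sub_add_cancel, add_neg_cancel_right]
    exact max_eq_left (min_le_left _ _)
  · intro r hr
    have h0 : 0 ≤ κ⁻¹ * r := mul_nonneg (inv_nonneg.2 hκ.le) hr.1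
    have h1 : 0 ≤ κ⁻¹ * (1 - r) := mul_nonneg (inv_nonneg.2 hκ.le) (by linarith [hr.2])
    constructor
    · refine le_max_of_le_right (le_min (by linarith [hρR.1]) (le_max_of_le_right
        (le_min (by linarith [hρL.1]) (hGr r).1)))
    · refine max_le (by linarith [hρR.2]) (min_le_of_right_le (max_le (by linarith [hρL.2])
        (min_le_of_right_le (hGr r).2)))
  · intro r hr
    have h0 : 1 ≤ κ⁻¹ * r := by
      rw [← div_eq_inv_mul, one_le_div hκ]; exact hr.1
    have h1 : 1 ≤ κ⁻¹ * (1 - r) := by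
      rw [← div_eq_inv_mul, one_le_div hκ]; linarith [hr.2]
    have h2 := hGr r
    rw [← hGu r hr]
    beta_reduce
    rw [min_eq_right (show G r ≤ ρL + κ⁻¹ * r by linarith [hρL.1, h2.2]),
      max_eq_right (show ρL + -κ⁻¹ * r ≤ G r by linarith [hρL.2, h2.1]),
      min_eq_right (by linarith [hρR.1, h2.2]), max_eq_right (by linarith [hρR.2, h2.1])]

theorem card_near_boundary_le {N : ℕ} {κ : ℝ} (hκ : 0 < κ) (hκ' : κ < 1) :
    (((Finset.Icc 1 N).filter fun k : ℕ => ¬(k / (N : ℝ) ∈ Set.Icc κ (1 - κ))).card : ℝ)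
      ≤ 2 * κ * N + 1 := by
  rcases Nat.eq_zero_or_pos N with rfl | hN
  · simp
  have hN0 : (0 : ℝ) < N := by exact_mod_cast hN
  have hsub : (Finset.Icc 1 N).filter (fun k : ℕ => ¬(k / (N : ℝ) ∈ Set.Icc κ (1 - κ)))
      ⊆ Finset.Ioc 0 ⌊κ * N⌋₊ ∪ Finset.Ioc ⌊(1 - κ) * N⌋₊ N := by
    intro k hk
    simp only [Finset.mem_filter, Finset.mem_Icc, Set.mem_Icc, not_and_or, not_le] at hk
    rw [Finset.mem_union, Finset.mem_Ioc, Finset.mem_Ioc]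
    rcases hk with ⟨⟨h1, h2⟩, h3 | h3⟩
    · exact Or.inl ⟨h1, Nat.le_floor ((div_lt_iff₀ hN0).1 h3).le⟩
    · refine Or.inr ⟨?_, h2⟩
      rw [Nat.floor_lt (mul_nonneg (by linarith) hN0.le)]
      exact (lt_div_iff₀ hN0).1 h3
  have h1 : ((Finset.Ioc 0 ⌊κ * N⌋₊).card : ℝ) ≤ κ * N := by
    rw [Nat.card_Ioc, Nat.sub_zero]
    exact Nat.floor_le (by positivity)
  have h2 : ((Finset.Ioc ⌊(1 - κ) * N⌋₊ N).card : ℝ) ≤ κ * N + 1 := by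
    have hle : ⌊(1 - κ) * N⌋₊ ≤ N :=
      Nat.floor_le_of_le (by nlinarith)
    rw [Nat.card_Ioc, Nat.cast_sub hle]
    linarith [Nat.lt_floor_add_one ((1 - κ) * (N : ℝ))]
  have h3 : (((Finset.Icc 1 N).filter fun k : ℕ =>
      ¬(k / (N : ℝ) ∈ Set.Icc κ (1 - κ))).card : ℝ)
      ≤ (Finset.Ioc 0 ⌊κ * N⌋₊).card + (Finset.Ioc ⌊(1 - κ) * N⌋₊ N).card := by
    exact_mod_cast (Finset.card_le_card hsub).trans (Finset.card_union_le _ _)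
  linarith

/-- The initial one-point function is `ℓ²`-close to a function of Dirichlet energy `O(1 / N)`. -/
theorem IsInitialLaw.exists_approximation {N : ℕ} (hN : 2 ≤ N) {u₀ : ℝ → ℝ} {nL nR : ℕ}
    {μ : PMF (Config N N)} (h : IsInitialLaw N u₀ nL nR μ)
    (hrange : ∀ r ∈ Set.Icc (0 : ℝ) 1, u₀ r ∈ Set.Icc (0 : ℝ) 1) {κ : ℝ} (hκ : 0 < κ)
    (hκ' : κ < 1 / 2) {K : NNReal}
    (hK : ∀ ρL ∈ Set.Icc (0 : ℝ) 1, ∀ ρR ∈ Set.Icc (0 : ℝ) 1, ∃ F : ℝ → ℝ,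
      LipschitzWith K F ∧ F 0 = ρL ∧ F 1 = ρR ∧
      (∀ r ∈ Set.Icc (0 : ℝ) 1, F r ∈ Set.Icc (0 : ℝ) 1) ∧
      ∀ r ∈ Set.Icc κ (1 - κ), F r = u₀ r) :
    ∃ f : Site N N → ℝ, dirichlet (rate N N) f f ≤ (K : ℝ) ^ 2 / N ∧
      ∑ z, (mean μ (occ z) - f z) ^ 2 ≤ 2 * κ * N + 1 := by
  have hN1 : 1 ≤ N := by omega
  have hN0 : (0 : ℝ) < N := by positivity
  obtain ⟨ρL, hL, ρR, hR, hρL, hρR⟩ := h.exists_reservoir_means hN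
  obtain ⟨F, hF, hF0, hF1, hF01, hFu⟩ := hK ρL hL ρR hR
  refine ⟨fun x => F (min ((position x : ℝ) / N) 1), ?_, ?_⟩
  · have hb (k : ℕ) : (F (min ((k : ℝ) / N) 1) - F (min (((k + 1 : ℕ) : ℝ) / N) 1)) ^ 2
        ≤ (K / N) ^ 2 := by
      rw [← sq_abs]
      refine pow_le_pow_left₀ (abs_nonneg _) ?_ 2
      rw [← Real.dist_eq]
      refine (hF.dist_le_mul _ _).trans ?_
      rw [div_eq_mul_one_div (K : ℝ)]
      refine mul_le_mul_of_nonneg_left ?_ K.2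
      rw [Real.dist_eq]
      refine (abs_min_sub_min_le_max _ _ _ _).trans (max_le (le_of_eq ?_) (by simp))
      rw [← sub_div, abs_div, abs_of_pos hN0]
      simp
    refine (dirichlet_comp_position_le hN1 (h := fun k => F (min ((k : ℝ) / N) 1)) hb).trans_eq ?_
    field_simp
  · have hright : min (((N + 1 : ℕ) : ℝ) / N) 1 = 1 := by
      refine min_eq_right ((one_le_div hN0).2 ?_)
      push_cast; linarith
    have hleft (z : Fin N) : mean μ (occ (Sum.inr (Sum.inl z))) = ρL := hρL z
    have hright' (z : Fin N) : mean μ (occ (Sum.inr (Sum.inr z))) = ρR := hρR z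
    have hchan (z : Channel N) : mean μ (occ (Sum.inl z)) = u₀ ((z : ℕ) / (N : ℝ)) := h.profile z
    simp only [Fintype.sum_sum_type, position, hleft, hright', hchan, hright, hF1, sub_self,
      Nat.cast_zero, zero_div, min_eq_left zero_le_one, hF0, ne_eq, OfNat.ofNat_ne_zero,
      not_false_eq_true, zero_pow, Finset.sum_const_zero, add_zero]
    rw [sum_channel fun k => (u₀ ((k : ℕ) / (N : ℝ)) - F (min ((k : ℝ) / N) 1)) ^ 2]
    refine le_trans ?_ (card_near_boundary_le (N := N) hκ (by linarith))
    rw [Finset.card_filter]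
    push_cast
    refine Finset.sum_le_sum fun k hk => ?_
    rw [Finset.mem_Icc] at hk
    have hk1 : (k : ℝ) / N ≤ 1 := (div_le_one hN0).2 (by exact_mod_cast hk.2)
    have hk01 : (k : ℝ) / N ∈ Set.Icc (0 : ℝ) 1 := ⟨by positivity, hk1⟩
    rw [min_eq_left hk1]
    split_ifs with hin
    · rw [hFu _ hin]; simp
    · have h1 := hrange _ hk01
      have h2 := hF01 _ hk01
      exact (sq_le_one_iff_abs_le_one _).2
        (abs_le.2 ⟨by linarith [h1.1, h2.2], by linarith [h1.2, h2.1]⟩)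

/-! ### Decay of the correlations -/

theorem eventually_abs_correlation_lt (u₀ : ℝ → ℝ) (hu₀ : ContDiffOn ℝ 1 u₀ (Set.Ioo 0 1))
    (hu₀_range : ∀ r ∈ Set.Icc (0 : ℝ) 1, u₀ r ∈ Set.Icc (0 : ℝ) 1)
    (nL nR : ℕ → ℕ) (μ : ∀ N : ℕ, PMF (Config N N))
    (hμ : ∀ᶠ N : ℕ in atTop, IsInitialLaw N u₀ (nL N) (nR N) (μ N)) (t : ℝ) (ht : 0 < t) :
    ∀ δ : ℝ, 0 < δ → ∀ᶠ N : ℕ in atTop, ∀ x₁ x₂ : Channel N, x₁ ≠ x₂ →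
      |correlation (μ N) ((N : ℝ) ^ 2 * t) (chan x₁) (chan x₂)| < δ := by
  intro δ hδ
  have hc : 0 < 2 + 4 / t := by positivity
  set c := 2 + 4 / t with hcdef
  -- the bound on `A ^ 2` has three parts, from the boundary layers of width `κ`, from the first
  -- phase of length `σ N²` and from a remainder of order `1 / N`; each is made at most `δ ^ 2 / 36`
  obtain ⟨κ, hκ, hκ', hκδ⟩ : ∃ κ : ℝ, 0 < κ ∧ κ < 1 / 2 ∧ c * (4 * κ) ≤ δ ^ 2 / 36 := by
    refine ⟨min (1 / 4) (δ ^ 2 / 36 / (4 * c)), by positivity,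
      (min_le_left _ _).trans_lt (by norm_num), ?_⟩
    calc c * (4 * min (1 / 4) (δ ^ 2 / 36 / (4 * c)))
        ≤ c * (4 * (δ ^ 2 / 36 / (4 * c))) := by gcongr; exact min_le_right _ _
      _ = δ ^ 2 / 36 := by field_simp
  obtain ⟨K, hK⟩ := exists_lipschitz_interpolation hu₀ hu₀_range hκ hκ'
  obtain ⟨σ, hσ, hσt, hσδ⟩ : ∃ σ : ℝ, 0 < σ ∧ σ ≤ t / 2 ∧
      c * (2 * σ * (K : ℝ) ^ 2) ≤ δ ^ 2 / 36 := by
    refine ⟨min (t / 2) (δ ^ 2 / 36 / (c * (2 * ((K : ℝ) ^ 2 + 1)))), by positivity,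
      min_le_left _ _, ?_⟩
    calc c * (2 * min (t / 2) (δ ^ 2 / 36 / (c * (2 * ((K : ℝ) ^ 2 + 1)))) * (K : ℝ) ^ 2)
        ≤ c * (2 * (δ ^ 2 / 36 / (c * (2 * ((K : ℝ) ^ 2 + 1)))) * ((K : ℝ) ^ 2 + 1)) := by
          gcongr
          · exact min_le_right _ _
          · linarith
      _ = δ ^ 2 / 36 := by field_simp
  have hinv : Tendsto (fun N : ℕ => (1 : ℝ) / N) atTop (𝓝 0) := tendsto_one_div_atTop_nhds_zero_nat
  have e1 : ∀ᶠ N : ℕ in atTop, c * 2 * (1 / (N : ℝ)) < δ ^ 2 / 36 := by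
    have := hinv.const_mul (c * 2)
    rw [mul_zero] at this
    exact this.eventually_lt_const (by positivity)
  have e2 : ∀ᶠ N : ℕ in atTop, 9 * (2 + t) / σ ^ 2 * (1 / (N : ℝ)) < δ / 3 := by
    have := hinv.const_mul (9 * (2 + t) / σ ^ 2)
    rw [mul_zero] at this
    exact this.eventually_lt_const (by positivity)
  have e3 : ∀ᶠ N : ℕ in atTop, 2 * (1 / (N : ℝ)) < δ / 3 := by
    have := hinv.const_mul 2
    rw [mul_zero] at this
    exact this.eventually_lt_const (by positivity)
  filter_upwards [hμ, e1, e2, e3, eventually_ge_atTop 2] with N hlaw h1 h2 h3 hN x₁ x₂ hx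
  have hN0 : (0 : ℝ) < N := by positivity
  have hN2 : (2 : ℝ) ≤ N := by exact_mod_cast hN
  have hx' : (chan x₁ : Site N N) ≠ chan x₂ := fun he => hx (Sum.inl_injective he)
  have hinit : 1 / ((N : ℝ) - 1) ≤ 2 * (1 / (N : ℝ)) := by
    rw [mul_one_div, div_le_div_iff₀ (by linarith) hN0]
    linarith
  have hup : correlation (μ N) ((N : ℝ) ^ 2 * t) (chan x₁) (chan x₂) ≤ 1 / ((N : ℝ) - 1) :=
    (isCorrelationFlow_correlation (μ N)).le (rate_nonneg N N) (a := 0)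
      (fun x y hxy => (le_abs_self _).trans (hlaw.abs_correlation_zero_le hN hxy))
      (by positivity) hx'
  obtain ⟨f, hfD, hf2⟩ := hlaw.exists_approximation hN hu₀_range hκ hκ' hK
  have hST : (N : ℝ) ^ 2 * σ < (N : ℝ) ^ 2 * t := by gcongr; linarith
  obtain ⟨A, hA, hdown⟩ := neg_correlation_le hN hlaw (S := (N : ℝ) ^ 2 * σ) (by positivity) hST
    f hx
  have hA' : A ^ 2 < (δ / 3) ^ 2 := by
    have hTS : (N : ℝ) ^ 2 * (t / 2) ≤ (N : ℝ) ^ 2 * t - (N : ℝ) ^ 2 * σ := by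
      rw [← mul_sub]; gcongr; linarith
    have hfac : 2 / (N : ℝ) + 2 * N / ((N : ℝ) ^ 2 * t - (N : ℝ) ^ 2 * σ) ≤ c / N := by
      calc _ ≤ 2 / (N : ℝ) + 2 * N / ((N : ℝ) ^ 2 * (t / 2)) := by gcongr
        _ = c / N := by rw [hcdef]; field_simp; ring
    have hsq : 2 * ((N : ℝ) ^ 2 * σ) * dirichlet (rate N N) f f
        + 2 * ∑ z, (mean (μ N) (occ z) - f z) ^ 2
        ≤ 2 * ((N : ℝ) ^ 2 * σ) * ((K : ℝ) ^ 2 / N) + 2 * (2 * κ * N + 1) := by gcongr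
    calc A ^ 2 ≤ c / N * (2 * ((N : ℝ) ^ 2 * σ) * ((K : ℝ) ^ 2 / N) + 2 * (2 * κ * N + 1)) := by
          refine hA.trans (mul_le_mul hfac hsq ?_ (by positivity))
          have := dirichlet_self_nonneg (rate_nonneg N N) f
          positivity
      _ = c * (2 * σ * (K : ℝ) ^ 2) + c * (4 * κ) + c * 2 * (1 / (N : ℝ)) := by
          field_simp; ring
      _ < (δ / 3) ^ 2 := by nlinarith [sq_pos_of_pos hδ]
  have hA3 : A < δ / 3 := lt_of_pow_lt_pow_left₀ 2 (by positivity) hA'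
  have hlast : 9 * (N : ℝ) ^ 2 / ((N : ℝ) ^ 2 * σ) ^ 2
      * (N + 1 + ((N : ℝ) ^ 2 * t - (N : ℝ) ^ 2 * σ) / N)
      ≤ 9 * (2 + t) / σ ^ 2 * (1 / (N : ℝ)) := by
    calc _ ≤ 9 * (N : ℝ) ^ 2 / ((N : ℝ) ^ 2 * σ) ^ 2 * (N + N + (N : ℝ) ^ 2 * t / N) := by
          gcongr
          · linarith
          · have : 0 ≤ (N : ℝ) ^ 2 * σ := by positivity
            linarith
      _ = _ := by field_simp; ring
  rw [abs_lt]
  constructor <;> linarith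

end Stirring

theorem theorem2 (u₀ : ℝ → ℝ) (hu₀ : ContDiffOn ℝ 1 u₀ (Set.Ioo 0 1))
    (hu₀_range : ∀ r ∈ Set.Icc (0 : ℝ) 1, u₀ r ∈ Set.Icc (0 : ℝ) 1)
    (nL nR : ℕ → ℕ) (μ : ∀ N : ℕ, PMF (Stirring.Config N N))
    (hμ : ∀ᶠ N : ℕ in atTop, Stirring.IsInitialLaw N u₀ (nL N) (nR N) (μ N))
    (t : ℝ) (ht : 0 < t) :
    ∀ δ : ℝ, 0 < δ → ∀ᶠ N : ℕ in atTop, ∀ x₁ x₂ : Stirring.Channel N, x₁ ≠ x₂ →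
      |Stirring.expect (μ N) ((N : ℝ) ^ 2 * t)
            (fun η => Stirring.occ (Stirring.chan x₁) η * Stirring.occ (Stirring.chan x₂) η)
          - Stirring.expect (μ N) ((N : ℝ) ^ 2 * t) (Stirring.occ (Stirring.chan x₁))
            * Stirring.expect (μ N) ((N : ℝ) ^ 2 * t) (Stirring.occ (Stirring.chan x₂))| < δ :=
  Stirring.eventually_abs_correlation_lt u₀ hu₀ hu₀_range nL nR μ hμ t ht
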